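/- **Theorem (Burgess).** There is a function $\eta$ on the positive integers with $\eta(q)\to 0$ as $q\to\infty$ such that the following holds. Let $V\colon\mathbf{R}\to\mathbf{C}$ be a smooth function with compact support contained in the open interval $]1,2[$, and let $l\ge 1$ be an integer. Then there is a constant $C=C(V,l)>0$ such that, for every prime $q$, every non-trivial Dirichlet character $\chi$ modulo $q$ (with $\chi(n)=0$ when $q\mid n$), and every real number $N\ge 1$ satisfying $$q^{\frac{1}{2l}}\le N<\tfrac12\,q^{\frac12+\frac1{4l}},$$ one has $$\Bigl|\sum_{n\in\mathbf{Z}}\chi(n)\,V\Bigl(\frac nN\Bigr)\Bigr|\le C\,q^{\eta(q)}\,N\,\Bigl(\frac{N}{q^{\frac14+\frac1{4l}}}\Bigr)^{-1/l}.$$ -/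

import Mathlib

open Filter Topology
open scoped ContDiff

/-- `V` belongs to `C_c^∞(]1,2[)`: it is smooth on `ℝ`, and its closed support is compact and
contained in the open interval `]1,2[`. -/
def IsSmoothBump (V : ℝ → ℂ) : Prop :=
  ContDiff ℝ ∞ V ∧ HasCompactSupport V ∧ tsupport V ⊆ Set.Ioo 1 2

/-- The smoothed character sum `S_V(χ, N) = ∑_{n ∈ ℤ} χ(n) V(n / N)`
(a finite sum when `V` has compact support and `N > 0`). -/
noncomputable def smoothCharSum {q : ℕ} (V : ℝ → ℂ) (χ : DirichletCharacter ℂ q) (N : ℝ) : ℂ :=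
  ∑' n : ℤ, χ (n : ZMod q) * V ((n : ℝ) / N)

/-! Burgess's method. The sum is averaged over the shifts n ↦ n + ab with a ≤ A ≈ N / q^(1/2l) and b
≤ B ≈ q^(1/2l), using χ(n + ab) = χ(a) χ(n/a + b). Abel summation in b removes V, which leaves sums
over (a, n) of |∑_{b ≤ k} χ(n/a + b)|. Because 2AN < q, the fractions n/a rarely coincide modulo q
(`card_collisions_le`), so Hölder and Cauchy–Schwarz (`sum_comp_pow_le`) pass to the 2l-th moment of
the short sums over all residues (`sum_norm_pow_le`). Expanding that moment leaves complete sums of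
products of χ^{±1}(b_j - x), which need Weil's square-root bound.

Weil's bound is proved from scratch. Stepanov's auxiliary polynomial (`stepanov_card_le`) bounds
from above the number of x in a finite extension with f(x) of given norm; summing over the norms,
this gives power sums S_j = O(p^(j/2)). By unique factorization the S_j are the power sums of an
L-function (`sum_lPowerSum_mul_lCoeff`), and that L-function is a polynomial
(`lCoeff_evalChar_eq_zero`). Its zeros therefore have modulus at least p^(-1/2), and its linear
coefficient, which is the wanted character sum, is at most √p times a bound for its degree. -/

/-! ### Stepanov's method over a finite field -/

open Polynomial in
theorem exists_pow_mul_hasseDeriv_pow {R : Type*} [CommRing R] (f : R[X]) (t k : ℕ) :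
    ∃ W : R[X], W.natDegree ≤ k * f.natDegree ∧ f ^ k * hasseDeriv k (f ^ t) = f ^ t * W := by
  induction t generalizing k with
  | zero =>
    rcases Nat.eq_zero_or_pos k with rfl | hk
    · exact ⟨1, by simp⟩
    · exact ⟨0, by simp, by simp [hasseDeriv_apply_one k hk]⟩
  | succ t ih =>
    choose W hW hfW using ih
    have hV : ∀ a : ℕ, ∃ V : R[X], V.natDegree ≤ a * f.natDegree ∧
        f ^ a * hasseDeriv a f = f * V := by
      intro a
      rcases a with _ | a
      · exact ⟨1, by simp⟩
      · refine ⟨f ^ a * hasseDeriv (a + 1) f, ?_, by ring⟩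
        refine natDegree_mul_le.trans ?_
        have h1 : (f ^ a).natDegree ≤ a * f.natDegree := natDegree_pow_le
        have h2 := natDegree_hasseDeriv_le f (a + 1)
        rw [add_mul]
        omega
    choose V hV hfV using hV
    refine ⟨∑ x ∈ Finset.HasAntidiagonal.antidiagonal k, V x.1 * W x.2, ?_, ?_⟩
    · refine natDegree_sum_le_of_forall_le _ _ fun x hx => natDegree_mul_le.trans ?_
      rw [← Finset.HasAntidiagonal.mem_antidiagonal.1 hx, add_mul]
      exact add_le_add (hV _) (hW _)
    · rw [pow_succ' f t, hasseDeriv_mul, Finset.mul_sum, Finset.mul_sum]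
      refine Finset.sum_congr rfl fun x hx => ?_
      rw [← Finset.HasAntidiagonal.mem_antidiagonal.1 hx, pow_add]
      linear_combination (f ^ x.2 * hasseDeriv x.2 (f ^ t)) * hfV x.1 + f * V x.1 * hfW x.2

open Polynomial in
-- Two features matter for Stepanov's method: the degree bound does not involve t, and T is linear
-- in r, so that vanishing of derivatives becomes a small linear system.
theorem exists_linearMap_pow_mul_hasseDeriv_mul_pow {R : Type*} [CommRing R] (f : R[X])
    (t k : ℕ) :
    ∃ T : R[X] →ₗ[R] R[X], ∀ r : R[X], (T r).natDegree ≤ r.natDegree + k * f.natDegree ∧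
      f ^ k * hasseDeriv k (r * f ^ t) = f ^ t * T r := by
  choose W hW hfW using fun b => exists_pow_mul_hasseDeriv_pow f t b
  refine ⟨∑ x ∈ Finset.HasAntidiagonal.antidiagonal k,
    (LinearMap.mulLeft R (f ^ x.1 * W x.2)).comp (hasseDeriv x.1), fun r => ⟨?_, ?_⟩⟩
  · rw [LinearMap.sum_apply]
    refine natDegree_sum_le_of_forall_le _ _ fun x hx => ?_
    rw [LinearMap.comp_apply, LinearMap.mulLeft_apply,
      ← Finset.HasAntidiagonal.mem_antidiagonal.1 hx, add_mul]
    refine natDegree_mul_le.trans ?_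
    have h1 : (f ^ x.1 * W x.2).natDegree ≤ x.1 * f.natDegree + x.2 * f.natDegree :=
      natDegree_mul_le.trans (add_le_add natDegree_pow_le (hW _))
    have h2 := natDegree_hasseDeriv_le r x.1
    omega
  · rw [LinearMap.sum_apply, hasseDeriv_mul, Finset.mul_sum, Finset.mul_sum]
    refine Finset.sum_congr rfl fun x hx => ?_
    rw [LinearMap.comp_apply, LinearMap.mulLeft_apply,
      ← Finset.HasAntidiagonal.mem_antidiagonal.1 hx, pow_add]
    linear_combination (f ^ x.1 * hasseDeriv x.1 r) * hfW x.2

open Polynomial in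
-- The order of vanishing at 0 separates the terms. As X * h has a simple zero there, term (u, v)
-- has order in [us + v(ds+1), us + v(ds+1) + s), and these intervals are disjoint because u < d.
-- The nonzero term with least u + dv thus contributes the lowest coefficient alone.
theorem sum_mul_pow_mul_X_pow_ne_zero {E : Type*} [Field E] (h : E[X]) (h0 : h.coeff 0 ≠ 0)
    {d s J : ℕ} (r : Fin d × Fin J → E[X]) (hr : ∀ i, r i ∈ degreeLT E s) (hr0 : r ≠ 0) :
    ∑ i, r i * (X * h) ^ ((i.1 : ℕ) * s) * X ^ ((i.2 : ℕ) * (d * s + 1)) ≠ 0 := by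
  classical
  obtain ⟨i₁, hi₁⟩ := Function.ne_iff.1 hr0
  obtain ⟨i₀, hi₀, hmin⟩ := Finset.exists_min_image
    (Finset.univ.filter fun i => r i ≠ 0) (fun i => (i.1 : ℕ) + d * (i.2 : ℕ))
    ⟨i₁, by simpa using hi₁⟩
  have hri₀ : r i₀ ≠ 0 := by simpa using hi₀
  have hlt : (r i₀).natTrailingDegree < s := by
    refine lt_of_le_of_lt (natTrailingDegree_le_natDegree _) ?_
    exact (natDegree_lt_iff_degree_lt hri₀).2 (mem_degreeLT.1 (hr i₀))
  intro hsum
  have hc := congrArg (fun P : E[X] => P.coeff ((i₀.1 : ℕ) * s + (i₀.2 : ℕ) * (d * s + 1) +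
    (r i₀).natTrailingDegree)) hsum
  simp only [finsetSum_coeff, coeff_zero] at hc
  rw [Finset.sum_eq_single i₀] at hc
  · rw [show r i₀ * (X * h) ^ ((i₀.1 : ℕ) * s) * X ^ ((i₀.2 : ℕ) * (d * s + 1)) =
      X ^ ((i₀.1 : ℕ) * s + (i₀.2 : ℕ) * (d * s + 1)) * (r i₀ * h ^ ((i₀.1 : ℕ) * s)) by ring,
      add_comm _ (natTrailingDegree _), coeff_X_pow_mul, coeff_mul,
      Finset.sum_eq_single ((r i₀).natTrailingDegree, 0)] at hc
    · rcases mul_eq_zero.1 hc with hc | hc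
      · exact hri₀ (trailingCoeff_eq_zero.1 hc)
      · rw [coeff_zero_eq_eval_zero, eval_pow, ← coeff_zero_eq_eval_zero] at hc
        exact h0 (eq_zero_of_pow_eq_zero hc)
    · intro x hx hne
      have hx' := Finset.HasAntidiagonal.mem_antidiagonal.1 hx
      rw [coeff_eq_zero_of_lt_natTrailingDegree, zero_mul]
      by_contra! hle
      exact hne (Prod.ext (by simp; omega) (by simp; omega))
    · simp
  · intro i _ hne
    by_cases hri : r i = 0
    · simp [hri]
    rw [show r i * (X * h) ^ ((i.1 : ℕ) * s) * X ^ ((i.2 : ℕ) * (d * s + 1)) =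
      X ^ ((i.1 : ℕ) * s + (i.2 : ℕ) * (d * s + 1)) * (r i * h ^ ((i.1 : ℕ) * s)) by ring,
      coeff_X_pow_mul', if_neg]
    have h1 := hmin i (by simpa using hri)
    have hi := i.1.2
    have hi' := i₀.1.2
    have h2 : (i₀.1 : ℕ) + d * (i₀.2 : ℕ) ≠ (i.1 : ℕ) + d * (i.2 : ℕ) := by
      intro heq
      have hmod := congrArg (· % d) heq
      simp only [Nat.add_mul_mod_self_left, Nat.mod_eq_of_lt hi, Nat.mod_eq_of_lt hi'] at hmod
      have hd : 0 < d := by omega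
      rw [hmod, Nat.add_left_cancel_iff, Nat.mul_right_inj hd.ne'] at heq
      exact hne (Prod.ext (Fin.ext hmod.symm) (Fin.ext heq.symm))
    have h3 : (i₀.2 : ℕ) ≤ i.2 := by
      by_contra! hlt'
      have : d * ((i.2 : ℕ) + 1) ≤ d * i₀.2 := Nat.mul_le_mul_left _ hlt'
      rw [mul_add] at this
      omega
    have h4 : (i₀.1 : ℕ) + d * (i₀.2 : ℕ) + 1 ≤ (i.1 : ℕ) + d * (i.2 : ℕ) := by omega
    have h5 := Nat.mul_le_mul_right s h4
    push Not
    calc (i₀.1 : ℕ) * s + (i₀.2 : ℕ) * (d * s + 1) + (r i₀).natTrailingDegree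
        < (i₀.1 : ℕ) * s + (i₀.2 : ℕ) * (d * s + 1) + s := by omega
      _ = ((i₀.1 : ℕ) + d * (i₀.2 : ℕ) + 1) * s + i₀.2 := by ring
      _ ≤ ((i.1 : ℕ) + d * (i.2 : ℕ)) * s + i.2 := by omega
      _ = (i.1 : ℕ) * s + (i.2 : ℕ) * (d * s + 1) := by ring
  · simp

open Polynomial in
-- Dimension count: d * J * s unknown coefficients against ℓ polynomial equations, each with at most
-- s + ℓm + J coefficients.
theorem exists_ne_zero_forall_sum_linearMap_eq_zero {E : Type*} [Field E] {d J s ℓ m : ℕ}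
    (a : E) (T : ℕ → ℕ → E[X] →ₗ[E] E[X])
    (hT : ∀ t k r, (T t k r).natDegree ≤ r.natDegree + k * m)
    (hJ : ℓ * (s + ℓ * m + J) < d * J * s) :
    ∃ r : Fin d × Fin J → E[X], (∀ i, r i ∈ degreeLT E s) ∧ r ≠ 0 ∧
      ∀ k < ℓ, ∑ i, C (a ^ (i.1 : ℕ)) * X ^ (i.2 : ℕ) * T (i.1 * s) k (r i) = 0 := by
  classical
  let Φ : (Fin d × Fin J → degreeLT E s) →ₗ[E] (Fin ℓ × Fin (s + ℓ * m + J) → E) :=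
    LinearMap.pi fun z => (lcoeff E (z.2 : ℕ)).comp (∑ i : Fin d × Fin J,
      (LinearMap.mulLeft E (C (a ^ (i.1 : ℕ)) * X ^ (i.2 : ℕ))).comp
        ((T (i.1 * s) z.1).comp ((degreeLT E s).subtype.comp (LinearMap.proj i))))
  have hfin : Module.finrank E (degreeLT E s) = s := by
    rw [(degreeLTEquiv E s).finrank_eq, Module.finrank_fin_fun]
  have hker : LinearMap.ker Φ ≠ ⊥ := by
    apply LinearMap.ker_ne_bot_of_finrank_lt
    simpa [Module.finrank_pi_fintype, hfin, mul_comm s] using hJ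
  obtain ⟨r, hr, hr0⟩ := Submodule.exists_mem_ne_zero_of_ne_bot hker
  refine ⟨fun i => (r i : E[X]), fun i => (r i).2, ?_, ?_⟩
  · contrapose! hr0
    ext1 i
    exact Subtype.ext (congrFun hr0 i)
  · intro k hk
    ext n
    rw [coeff_zero]
    by_cases hn : n < s + ℓ * m + J
    · have := congrFun (LinearMap.mem_ker.1 hr) (⟨k, hk⟩, ⟨n, hn⟩)
      simpa [Φ, mul_assoc] using this
    · apply coeff_eq_zero_of_natDegree_lt
      refine lt_of_le_of_lt ?_ (not_lt.1 hn |> lt_of_lt_of_le (Nat.sub_one_lt (by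
        rintro h0
        have hs : s = 0 := by omega
        simp [hs] at hJ)))
      refine natDegree_sum_le_of_forall_le _ _ fun i _ => ?_
      dsimp only
      have h0 := natDegree_mul_le (p := C (a ^ (i.1 : ℕ)) * X ^ (i.2 : ℕ))
        (q := T (i.1 * s) k (r i))
      have h1 : (C (a ^ (i.1 : ℕ)) * X ^ (i.2 : ℕ) : E[X]).natDegree ≤ i.2 :=
        natDegree_C_mul_X_pow_le _ _
      have h2 := hT (i.1 * s) k (r i)
      have h3 : (r i : E[X]).natDegree ≤ s - 1 := by
        have := mem_degreeLT.1 (r i).2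
        by_cases h0 : (r i : E[X]) = 0
        · simp [h0]
        · have := (natDegree_lt_iff_degree_lt h0).2 this
          omega
      have h4 : k * m ≤ ℓ * m := Nat.mul_le_mul_right _ hk.le
      have h5 := i.2.2
      have hs : s ≠ 0 := by
        rintro rfl
        simp at hJ
      omega

open Polynomial in
theorem X_sub_C_pow_dvd_iff_forall_hasseDeriv {R : Type*} [CommRing R] (P : R[X]) (x : R)
    (ℓ : ℕ) : (X - C x) ^ ℓ ∣ P ↔ ∀ k < ℓ, (hasseDeriv k P).eval x = 0 := by
  rw [X_sub_C_pow_dvd_iff, X_pow_dvd_iff]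
  refine forall₂_congr fun k _ => ?_
  rw [← taylor_coeff, taylor_apply]

/-- Stepanov's method for the equation `f(x) ^ s = a` over a finite field with `d * s + 1`
elements, where `f = X * h` has a simple root at `0`. -/
theorem stepanov_card_le {E : Type*} [Field E] [Fintype E] [DecidableEq E]
    (h : Polynomial E) (h0 : h.coeff 0 ≠ 0) {d s J ℓ : ℕ}
    (hcard : Fintype.card E = d * s + 1) {a : E} (ha : a ≠ 0) (hℓ : ℓ ≤ Fintype.card E)
    (hJ : ℓ * (s + ℓ * (Polynomial.X * h).natDegree + J) < d * J * s) :
    (Finset.univ.filter fun x : E => (Polynomial.X * h).eval x ^ s = a).card * ℓ ≤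
      ((Polynomial.X * h).natDegree + J) * Fintype.card E := by
  open Polynomial in
  set f : E[X] := X * h with hf
  set S := Finset.univ.filter fun x : E => f.eval x ^ s = a with hS
  choose T hT using fun t k => exists_linearMap_pow_mul_hasseDeriv_mul_pow f t k
  obtain ⟨r, hrdeg, hr0, hr⟩ := exists_ne_zero_forall_sum_linearMap_eq_zero a T
    (fun t k r => (hT t k r).1) hJ
  have hs : s ≠ 0 := by
    rintro rfl
    simp at hJ
  have hR := sum_mul_pow_mul_X_pow_ne_zero h h0 r hrdeg hr0
  set R := ∑ i, r i * (X * h) ^ ((i.1 : ℕ) * s) * X ^ ((i.2 : ℕ) * (d * s + 1)) with hRdef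
  have hdvd : ∀ x ∈ S, (X - C x) ^ ℓ ∣ R := by
    intro x hx
    have hxa : f.eval x ^ s = a := by simpa [hS] using hx
    have hfx : f.eval x ≠ 0 := by
      intro h1
      rw [h1, zero_pow hs] at hxa
      exact ha hxa.symm
    -- With Q the cardinality of E, X^Q - x = (X - x)^Q, so modulo (X - x)^ℓ the power X^Q is the
    -- constant x. This lets R have large degree at no cost in vanishing conditions.
    have hXQ : (X - C x) ^ ℓ ∣ (X ^ Fintype.card E - C x : E[X]) := by
      have : (X - C x) ^ Fintype.card E = (X ^ Fintype.card E - C x : E[X]) := by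
        rw [← FiniteField.expand_card]
        simp
      rw [← this]
      exact pow_dvd_pow _ hℓ
    have hdiff : (X - C x) ^ ℓ ∣ R - ∑ i, C x ^ (i.2 : ℕ) * (r i * f ^ ((i.1 : ℕ) * s)) := by
      rw [hRdef, ← Finset.sum_sub_distrib]
      refine Finset.dvd_sum fun i _ => ?_
      have h1 := hXQ.trans (sub_dvd_pow_sub_pow (X ^ Fintype.card E : E[X]) (C x) i.2)
      rw [← pow_mul, hcard, mul_comm _ (i.2 : ℕ)] at h1
      have h2 : r i * f ^ ((i.1 : ℕ) * s) * X ^ ((i.2 : ℕ) * (d * s + 1)) -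
          C x ^ (i.2 : ℕ) * (r i * f ^ ((i.1 : ℕ) * s)) = (r i * f ^ ((i.1 : ℕ) * s)) *
            (X ^ ((i.2 : ℕ) * (d * s + 1)) - C x ^ (i.2 : ℕ)) := by
        rw [mul_sub, mul_comm (C x ^ _)]
      rw [h2]
      exact h1.mul_left _
    rw [← sub_add_cancel R (∑ i, C x ^ (i.2 : ℕ) * (r i * f ^ ((i.1 : ℕ) * s)))]
    refine dvd_add hdiff ?_
    rw [X_sub_C_pow_dvd_iff_forall_hasseDeriv]
    intro k hk
    have h1 := congrArg (eval x) (hr k hk)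
    rw [eval_zero] at h1
    -- After multiplication by f(x)^k, the relation f(x)^s = a turns each f(x)^(us) into a^u, and
    -- what remains is the linear system solved by r.
    have h2 : f.eval x ^ k * (hasseDeriv k
        (∑ i, C x ^ (i.2 : ℕ) * (r i * f ^ ((i.1 : ℕ) * s)))).eval x = 0 := by
      rw [← h1, map_sum, eval_finsetSum, eval_finsetSum, Finset.mul_sum]
      refine Finset.sum_congr rfl fun i _ => ?_
      have h3 := congrArg (eval x) (hT (i.1 * s) k (r i)).2
      simp only [eval_mul, eval_pow] at h3
      rw [← C_pow, ← smul_eq_C_mul, map_smul, eval_smul, smul_eq_mul]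
      simp only [eval_mul, eval_pow, eval_C, eval_X]
      rw [← hxa, ← pow_mul, mul_comm s]
      linear_combination x ^ (i.2 : ℕ) * h3
    exact (mul_eq_zero.1 h2).resolve_left (pow_ne_zero _ hfx)
  have hprod : ∏ x ∈ S, (X - C x) ^ ℓ ∣ R := by
    refine Finset.prod_dvd_of_coprime ?_ hdvd
    intro x _ y _ hxy
    exact (pairwise_coprime_X_sub_C (s := fun z : E => z) Function.injective_id hxy).pow
  have hdeg := natDegree_le_of_dvd hprod hR
  rw [natDegree_prod_of_monic _ _ fun x _ => (monic_X_sub_C x).pow _] at hdeg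
  simp only [natDegree_pow, natDegree_X_sub_C, mul_one, Finset.sum_const, smul_eq_mul] at hdeg
  refine hdeg.trans (natDegree_sum_le_of_forall_le _ _ fun i _ => ?_)
  have hm : 1 ≤ f.natDegree := by
    rw [hf, natDegree_X_mul]
    · omega
    · rintro rfl
      simp at h0
  have h1 : (r i).natDegree ≤ s := by
    by_cases h0 : r i = 0
    · simp [h0]
    · exact ((natDegree_lt_iff_degree_lt h0).2 (mem_degreeLT.1 (hrdeg i))).le
  have h2 : (f ^ ((i.1 : ℕ) * s)).natDegree ≤ i.1 * s * f.natDegree := natDegree_pow_le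
  have h3 : (X ^ ((i.2 : ℕ) * (d * s + 1)) : E[X]).natDegree ≤ i.2 * (d * s + 1) :=
    natDegree_X_pow_le _
  have h4 : (i.1 : ℕ) + 1 ≤ d := i.1.2
  have h5 : (i.2 : ℕ) ≤ J := i.2.2.le
  calc (r i * f ^ ((i.1 : ℕ) * s) * X ^ ((i.2 : ℕ) * (d * s + 1))).natDegree
      ≤ s * 1 + i.1 * s * f.natDegree + i.2 * (d * s + 1) :=
        natDegree_mul_le.trans (add_le_add (natDegree_mul_le.trans
          (add_le_add (by simpa using h1) h2)) h3)
    _ ≤ s * f.natDegree + i.1 * s * f.natDegree + J * (d * s + 1) := by gcongr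
    _ = (((i.1 : ℕ) + 1) * s) * f.natDegree + J * (d * s + 1) := by ring
    _ ≤ (d * s + 1) * f.natDegree + J * (d * s + 1) := by
        gcongr
        exact (Nat.mul_le_mul_right _ h4).trans (Nat.le_succ _)
    _ = (f.natDegree + J) * Fintype.card E := by rw [hcard]; ring

/-! ### Norms and characteristic polynomials in field extensions -/

noncomputable instance GaloisField.instFintype (p : ℕ) [Fact p.Prime] (n : ℕ) :
    Fintype (GaloisField p n) :=
  Fintype.ofFinite _

/-- The characteristic polynomial of multiplication by `x`, as a power of the minimal
polynomial. -/
noncomputable def minpolyPow (K : Type*) {L : Type*} [Field K] [Field L] [Algebra K L] (x : L) :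
    Polynomial K :=
  minpoly K x ^ Module.finrank (IntermediateField.adjoin K {x}) L

section minpolyPow

variable {K L : Type*} [Field K] [Field L] [Algebra K L] [FiniteDimensional K L]

theorem monic_minpolyPow (x : L) : (minpolyPow K x).Monic :=
  (minpoly.monic (IsIntegral.of_finite K x)).pow _

theorem natDegree_minpoly_mul_finrank (x : L) :
    Module.finrank (IntermediateField.adjoin K {x}) L * (minpoly K x).natDegree =
      Module.finrank K L := by
  rw [← IntermediateField.adjoin.finrank (IsIntegral.of_finite K x), mul_comm,
    Module.finrank_mul_finrank]

theorem natDegree_minpolyPow (x : L) : (minpolyPow K x).natDegree = Module.finrank K L := by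
  rw [minpolyPow, Polynomial.natDegree_pow, natDegree_minpoly_mul_finrank]

theorem eval_minpolyPow (b : K) (x : L) :
    (minpolyPow K x).eval b = Algebra.norm K (algebraMap K L b - x) := by
  have hx := IsIntegral.of_finite K x
  have h1 : algebraMap K L b - x = algebraMap (IntermediateField.adjoin K {x}) L
      (algebraMap K _ b - IntermediateField.AdjoinSimple.gen K x) := by
    rw [map_sub, IntermediateField.AdjoinSimple.algebraMap_gen, ← IsScalarTower.algebraMap_apply]
  rw [h1, ← Algebra.norm_norm (S := IntermediateField.adjoin K {x}), Algebra.norm_algebraMap,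
    map_pow, minpolyPow, Polynomial.eval_pow]
  congr 1
  have h2 := charpoly_leftMulMatrix (IntermediateField.adjoin.powerBasis hx)
  rw [IntermediateField.adjoin.powerBasis_gen, IntermediateField.minpoly_gen] at h2
  rw [← h2, Matrix.eval_charpoly, Algebra.norm_eq_matrix_det
    (IntermediateField.adjoin.powerBasis hx).basis, map_sub, AlgHom.commutes]
  rfl

theorem minpolyPow_dvd_mul_iff_of_aeval_ne_zero {P g : Polynomial K} {x : L}
    (hx : Polynomial.aeval x P ≠ 0) : minpolyPow K x ∣ P * g ↔ minpolyPow K x ∣ g := by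
  refine ⟨fun h => ?_, fun h => h.mul_left _⟩
  have hirr := minpoly.irreducible (IsIntegral.of_finite K x)
  have hco : IsCoprime (minpoly K x) P :=
    (hirr.coprime_iff_not_dvd).2 fun h => hx ((minpoly.dvd_iff).1 h)
  exact (hco.pow_left).dvd_of_dvd_mul_left h

theorem minpolyPow_dvd_iff_of_aeval_eq_zero {P g : Polynomial K} (hP : Irreducible P) (hg : g ≠ 0)
    {x : L} (hx : Polynomial.aeval x P = 0) :
    minpolyPow K x ∣ g ↔
      Module.finrank (IntermediateField.adjoin K {x}) L ≤ multiplicity P g := by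
  have hirr := minpoly.irreducible (IsIntegral.of_finite K x)
  have hass : Associated (minpoly K x) P :=
    hirr.associated_of_dvd hP (minpoly.dvd K x hx)
  rw [minpolyPow, (hass.pow_pow).dvd_iff_dvd_left,
    (FiniteMultiplicity.of_not_isUnit hP.not_isUnit hg).pow_dvd_iff_le_multiplicity]

end minpolyPow

/-! ### Counting field elements by prime powers dividing a polynomial -/

section count

variable {p : ℕ} [Fact p.Prime]

open Polynomial

theorem card_aeval_eq_zero_galoisField {P : (ZMod p)[X]} (hP : Irreducible P) {j : ℕ}
    (hj : j ≠ 0) (hdvd : P.natDegree ∣ j) [DecidableEq (GaloisField p j)] :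
    (Finset.univ.filter fun x : GaloisField p j => aeval x P = 0).card = P.natDegree := by
  have hsplit : (P.map (algebraMap (ZMod p) (GaloisField p j))).Splits := by
    have h1 := (hP.natDegree_dvd_iff_dvd_X_pow_card_pow_sub_X).1 hdvd
    have h2 := FiniteField.splits_X_pow_nat_card_sub_X p (K := GaloisField p j)
    rw [GaloisField.card p j hj] at h2
    rw [Nat.card_zmod] at h1
    refine h2.of_dvd ?_ (map_dvd (mapRingHom _) h1)
    rw [Polynomial.map_ne_zero_iff (algebraMap (ZMod p) (GaloisField p j)).injective]
    exact FiniteField.X_pow_card_pow_sub_X_ne_zero _ hj (Fact.out : p.Prime).one_lt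
  rw [← card_rootSet_eq_natDegree (PerfectField.separable_of_irreducible hP) hsplit,
    ← Set.toFinset_card]
  congr 1
  ext x
  simp [mem_rootSet, hP.ne_zero]

open Classical in
-- An extra factor P creates exactly one new prime power divisor, P^(e+1) with e the old
-- multiplicity. It is the characteristic polynomial of the deg P roots of P in the extension of
-- degree j = (e+1) deg P, and of no element for other j.
theorem card_minpolyPow_dvd_mul {P g : (ZMod p)[X]} (hP : Irreducible P) (hg : g ≠ 0) {j : ℕ}
    (hj : j ≠ 0) :
    (Finset.univ.filter fun x : GaloisField p j => minpolyPow (ZMod p) x ∣ P * g).card =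
      (Finset.univ.filter fun x : GaloisField p j => minpolyPow (ZMod p) x ∣ g).card +
        if j = (multiplicity P g + 1) * P.natDegree then P.natDegree else 0 := by
  have hPg : P * g ≠ 0 := mul_ne_zero hP.ne_zero hg
  have hmul : multiplicity P (P * g) = multiplicity P g + 1 := by
    rw [multiplicity_mul hP.prime (FiniteMultiplicity.of_not_isUnit hP.not_isUnit hPg),
      multiplicity_self, add_comm]
  have key : ∀ x : GaloisField p j, minpolyPow (ZMod p) x ∣ P * g ↔
      minpolyPow (ZMod p) x ∣ g ∨
        (aeval x P = 0 ∧ j = (multiplicity P g + 1) * P.natDegree) := by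
    intro x
    by_cases hx : aeval x P = 0
    · have hdeg : (minpoly (ZMod p) x).natDegree = P.natDegree :=
        natDegree_eq_of_degree_eq (degree_eq_degree_of_associated
          ((minpoly.irreducible (IsIntegral.of_finite _ x)).associated_of_dvd hP
            (minpoly.dvd _ x hx)))
      have hr := natDegree_minpoly_mul_finrank (K := ZMod p) x
      rw [hdeg, GaloisField.finrank p hj] at hr
      rw [minpolyPow_dvd_iff_of_aeval_eq_zero hP hPg hx,
        minpolyPow_dvd_iff_of_aeval_eq_zero hP hg hx, hmul, Nat.le_succ_iff]
      simp only [hx, true_and, ← hr, Nat.mul_left_inj hP.natDegree_pos.ne']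
    · rw [minpolyPow_dvd_mul_iff_of_aeval_ne_zero hx]
      simp [hx]
  rw [Finset.filter_congr fun x _ => key x, Finset.filter_or, Finset.card_union_of_disjoint]
  · congr 1
    split_ifs with h
    · refine (congrArg Finset.card (Finset.filter_congr fun x _ => and_iff_left h)).trans ?_
      exact card_aeval_eq_zero_galoisField hP hj (h ▸ dvd_mul_left _ _)
    · simp [h]
  · rw [Finset.disjoint_filter]
    rintro x - h1 ⟨h2, h3⟩
    have hdeg : (minpoly (ZMod p) x).natDegree = P.natDegree :=
      natDegree_eq_of_degree_eq (degree_eq_degree_of_associated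
        ((minpoly.irreducible (IsIntegral.of_finite _ x)).associated_of_dvd hP
          (minpoly.dvd _ x h2)))
    have hr := natDegree_minpoly_mul_finrank (K := ZMod p) x
    rw [hdeg, GaloisField.finrank p hj] at hr
    rw [minpolyPow_dvd_iff_of_aeval_eq_zero hP hg h2,
      Nat.eq_of_mul_eq_mul_right hP.natDegree_pos (hr.trans h3)] at h1
    omega

open Classical in
-- Polynomial analogue of ∑_{d ∣ n} Λ(d) = log n, by induction on the irreducible factors.
theorem sum_card_minpolyPow_dvd {g : (ZMod p)[X]} (hg : g ≠ 0) {B : ℕ} (hB : g.natDegree ≤ B) :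
    ∑ j ∈ Finset.Icc 1 B,
      (Finset.univ.filter fun x : GaloisField p j => minpolyPow (ZMod p) x ∣ g).card =
        g.natDegree := by
  induction g using WfDvdMonoid.induction_on_irreducible with
  | zero => exact absurd rfl hg
  | unit u hu =>
    rw [natDegree_eq_zero_of_isUnit hu]
    refine Finset.sum_eq_zero fun j hj => ?_
    rw [Finset.card_eq_zero, Finset.filter_eq_empty_iff]
    intro x _ hdvd
    have h1 := natDegree_eq_zero_of_isUnit (isUnit_of_dvd_unit hdvd hu)
    have hj1 := (Finset.mem_Icc.1 hj).1
    rw [natDegree_minpolyPow, GaloisField.finrank p (by omega)] at h1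
    omega
  | mul g P hg0 hP ih =>
    rw [natDegree_mul hP.ne_zero hg0] at hB ⊢
    rw [Finset.sum_congr rfl fun j hj => card_minpolyPow_dvd_mul hP hg0
      (j := j) (by have := (Finset.mem_Icc.1 hj).1; omega), Finset.sum_add_distrib,
      ih hg0 (by omega), add_comm, Finset.sum_ite_eq', if_pos]
    rw [Finset.mem_Icc]
    have hpos := hP.natDegree_pos
    refine ⟨Nat.mul_pos (Nat.succ_pos _) hpos, le_trans ?_ hB⟩
    have h1 := natDegree_le_of_dvd (pow_multiplicity_dvd P g) hg0
    rw [natDegree_pow] at h1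
    rw [add_mul]
    omega

end count

/-! ### The L-function of a multiplicative function and Newton's identities -/

section newton

variable {p : ℕ} [Fact p.Prime]

open Polynomial

theorem finite_setOf_monic_natDegree_eq (p k : ℕ) [Fact p.Prime] :
    {g : (ZMod p)[X] | g.Monic ∧ g.natDegree = k}.Finite := by
  have : Finite (degreeLT (ZMod p) k) := Finite.of_equiv _ (degreeLTEquiv (ZMod p) k).symm.toEquiv
  exact Set.finite_coe_iff.1 (Finite.of_equiv _ (monicEquivDegreeLT (R := ZMod p) k).symm)

/-- The monic polynomials of degree `k` over `ZMod p`. -/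
noncomputable def monicsOfDegree (p k : ℕ) [Fact p.Prime] : Finset (ZMod p)[X] :=
  (finite_setOf_monic_natDegree_eq p k).toFinset

theorem mem_monicsOfDegree {k : ℕ} {g : (ZMod p)[X]} :
    g ∈ monicsOfDegree p k ↔ g.Monic ∧ g.natDegree = k := by
  simp [monicsOfDegree]

/-- The coefficients of the `L`-function of a completely multiplicative function on
polynomials. -/
noncomputable def lCoeff (Λ : (ZMod p)[X] →* ℂ) (k : ℕ) : ℂ :=
  ∑ g ∈ monicsOfDegree p k, Λ g

/-- The power sums attached to the `L`-function of a completely multiplicative function on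
polynomials. -/
noncomputable def lPowerSum (Λ : (ZMod p)[X] →* ℂ) (j : ℕ) : ℂ :=
  ∑ x : GaloisField p j, Λ (minpolyPow (ZMod p) x)

theorem lCoeff_zero (Λ : (ZMod p)[X] →* ℂ) : lCoeff Λ 0 = 1 := by
  have : monicsOfDegree p 0 = {1} := by
    ext g
    rw [mem_monicsOfDegree, Finset.mem_singleton]
    exact ⟨fun h => h.1.natDegree_eq_zero.1 h.2, by rintro rfl; simp⟩
  rw [lCoeff, this, Finset.sum_singleton, map_one]

open Classical in
theorem sum_filter_dvd_monicsOfDegree (Λ : (ZMod p)[X] →* ℂ) {P : (ZMod p)[X]} (hP : P.Monic)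
    {j k : ℕ} (hj : P.natDegree = j) (hjk : j ≤ k) :
    ∑ g ∈ (monicsOfDegree p k).filter (P ∣ ·), Λ g = Λ P * lCoeff Λ (k - j) := by
  rw [lCoeff, Finset.mul_sum]
  symm
  refine Finset.sum_bij (fun h _ => P * h) ?_ ?_ ?_ ?_
  · intro h hh
    rw [mem_monicsOfDegree] at hh
    rw [Finset.mem_filter, mem_monicsOfDegree, hP.natDegree_mul hh.1, hj, hh.2]
    exact ⟨⟨hP.mul hh.1, by omega⟩, dvd_mul_right _ _⟩
  · intro h _ h' _ he
    exact mul_left_cancel₀ hP.ne_zero he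
  · intro g hg
    rw [Finset.mem_filter, mem_monicsOfDegree] at hg
    obtain ⟨⟨hg, hdeg⟩, h, rfl⟩ := hg
    have hh := hP.of_mul_monic_left hg
    rw [hP.natDegree_mul hh] at hdeg
    exact ⟨h, mem_monicsOfDegree.2 ⟨hh, by omega⟩, rfl⟩
  · intro h _
    rw [map_mul]

/-- Newton's identities, equivalently the Euler product after logarithmic differentiation. Grouping
the pairs (x, cofactor) by their product g gives Λ g the weight deg g = k. -/
theorem sum_lPowerSum_mul_lCoeff (Λ : (ZMod p)[X] →* ℂ) (k : ℕ) :
    ∑ j ∈ Finset.Icc 1 k, lPowerSum Λ j * lCoeff Λ (k - j) = k * lCoeff Λ k := by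
  classical
  have h1 : ∀ j ∈ Finset.Icc 1 k, lPowerSum Λ j * lCoeff Λ (k - j) =
      ∑ g ∈ monicsOfDegree p k, Λ g *
        ((Finset.univ.filter fun x : GaloisField p j => minpolyPow (ZMod p) x ∣ g).card : ℂ) := by
    intro j hj
    rw [Finset.mem_Icc] at hj
    rw [lPowerSum, Finset.sum_mul]
    rw [Finset.sum_congr rfl fun x _ => (sum_filter_dvd_monicsOfDegree Λ (monic_minpolyPow x)
      ((natDegree_minpolyPow x).trans (GaloisField.finrank p (by omega))) hj.2).symm]
    simp_rw [Finset.sum_filter]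
    rw [Finset.sum_comm]
    refine Finset.sum_congr rfl fun g _ => ?_
    rw [← Finset.sum_filter, Finset.sum_const, nsmul_eq_mul, mul_comm]
  rw [Finset.sum_congr rfl h1, Finset.sum_comm, lCoeff, Finset.mul_sum]
  refine Finset.sum_congr rfl fun g hg => ?_
  rw [mem_monicsOfDegree] at hg
  rw [← Finset.mul_sum, ← Nat.cast_sum, sum_card_minpolyPow_dvd hg.1.ne_zero hg.2.le, hg.2,
    mul_comm]

/-- The completely multiplicative function `g ↦ ∏ j, ψ (g (b j)) ^ n j` on polynomials. -/
noncomputable def evalChar (ψ : MulChar (ZMod p) ℂ) {ι : Type*} [Fintype ι] (b : ι → ZMod p)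
    (n : ι → ℕ) : (ZMod p)[X] →* ℂ where
  toFun g := ∏ j, ψ (g.eval (b j)) ^ n j
  map_one' := by simp
  map_mul' g h := by simp [mul_pow, Finset.prod_mul_distrib]

theorem evalChar_apply (ψ : MulChar (ZMod p) ℂ) {ι : Type*} [Fintype ι] (b : ι → ZMod p)
    (n : ι → ℕ) (g : (ZMod p)[X]) : evalChar ψ b n g = ∏ j, ψ (g.eval (b j)) ^ n j :=
  rfl

/-- Adding a multiple of M = ∏_{j ≠ j₀} (X - b j) changes g only at b j₀, and deg M < k keeps g
monic of degree k. The map `F u` so obtained multiplies g(b j₀) by u and permutes the monic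
polynomials, hence the sum equals ψ(u) times itself with ψ(u) ≠ 1. -/
theorem lCoeff_evalChar_eq_zero {ψ : MulChar (ZMod p) ℂ} (hψ : ψ ≠ 1) {ι : Type*} [Fintype ι]
    {b : ι → ZMod p} {n : ι → ℕ} {j₀ : ι} (hn : n j₀ = 1) (hb : ∀ j, j ≠ j₀ → b j ≠ b j₀)
    {k : ℕ} (hk : Fintype.card ι ≤ k) : lCoeff (evalChar ψ b n) k = 0 := by
  classical
  obtain ⟨u, hu⟩ := MulChar.ne_one_iff.1 hψ
  set M : (ZMod p)[X] := ∏ j ∈ Finset.univ.erase j₀, (X - C (b j)) with hM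
  have hM0 : M.eval (b j₀) ≠ 0 := by
    rw [hM, eval_prod, Finset.prod_ne_zero_iff]
    intro j hj
    rw [eval_sub, eval_X, eval_C, sub_ne_zero]
    exact (hb j (Finset.ne_of_mem_erase hj)).symm
  have hMj : ∀ j, j ≠ j₀ → M.eval (b j) = 0 := by
    intro j hj
    rw [hM, eval_prod]
    exact Finset.prod_eq_zero (Finset.mem_erase.2 ⟨hj, Finset.mem_univ _⟩) (by simp)
  have hMdeg : M.degree < k := by
    rw [hM, degree_prod]
    simp only [degree_X_sub_C, Finset.sum_const, nsmul_eq_mul, mul_one]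
    rw [Finset.card_erase_of_mem (Finset.mem_univ _), Finset.card_univ]
    have : 0 < Fintype.card ι := Fintype.card_pos_iff.2 ⟨j₀⟩
    exact_mod_cast (by omega : Fintype.card ι - 1 < k)
  let F : ZMod p → (ZMod p)[X] → (ZMod p)[X] := fun v g =>
    g + C ((v - 1) * g.eval (b j₀) * (M.eval (b j₀))⁻¹) * M
  have hF0 : ∀ v g, (F v g).eval (b j₀) = v * g.eval (b j₀) := by
    intro v g
    simp only [F, eval_add, eval_mul, eval_C]
    field_simp
    ring
  have hFj : ∀ v g j, j ≠ j₀ → (F v g).eval (b j) = g.eval (b j) := by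
    intro v g j hj
    simp [F, hMj j hj]
  have hFmem : ∀ v, ∀ g ∈ monicsOfDegree p k, F v g ∈ monicsOfDegree p k := by
    intro v g hg
    rw [mem_monicsOfDegree] at hg ⊢
    have hdeg : (C ((v - 1) * g.eval (b j₀) * (M.eval (b j₀))⁻¹) * M).degree < g.degree := by
      refine ((degree_mul_le _ _).trans (add_le_add_left degree_C_le _)).trans_lt ?_
      rw [zero_add, degree_eq_natDegree hg.1.ne_zero, hg.2]
      exact hMdeg
    refine ⟨hg.1.add_of_left hdeg, ?_⟩
    rw [natDegree_eq_of_degree_eq (degree_add_eq_left_of_degree_lt hdeg), hg.2]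
  have hFF : ∀ v w, v * w = 1 → ∀ g, F w (F v g) = g := by
    intro v w hvw g
    have h1 : F w (F v g) = F v g + C ((w - 1) * (F v g).eval (b j₀) * (M.eval (b j₀))⁻¹) * M := rfl
    rw [h1, hF0]
    have h2 : F v g = g + C ((v - 1) * g.eval (b j₀) * (M.eval (b j₀))⁻¹) * M := rfl
    rw [h2, add_assoc, ← add_mul, ← C_add]
    have h3 : (v - 1) * g.eval (b j₀) * (M.eval (b j₀))⁻¹ +
        (w - 1) * (v * g.eval (b j₀)) * (M.eval (b j₀))⁻¹ = 0 := by
      linear_combination g.eval (b j₀) * (M.eval (b j₀))⁻¹ * hvw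
    rw [h3]
    simp
  have hsum : lCoeff (evalChar ψ b n) k = ψ u * lCoeff (evalChar ψ b n) k := by
    conv_lhs => rw [lCoeff]
    rw [lCoeff, Finset.mul_sum]
    symm
    refine Finset.sum_nbij' (F u) (F ((u⁻¹ : (ZMod p)ˣ) : ZMod p)) (hFmem _) (hFmem _) ?_ ?_ ?_
    · exact fun g _ => hFF _ _ (Units.mul_inv u) g
    · exact fun g _ => hFF _ _ (Units.inv_mul u) g
    · intro g _
      rw [evalChar_apply, evalChar_apply, ← Finset.mul_prod_erase _ _ (Finset.mem_univ j₀),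
        ← Finset.mul_prod_erase _ _ (Finset.mem_univ j₀), hF0, hn, pow_one, pow_one, map_mul,
        ← mul_assoc]
      congr 1
      exact Finset.prod_congr rfl fun j hj => by rw [hFj _ _ _ (Finset.ne_of_mem_erase hj)]
  have h4 : (ψ u - 1) * lCoeff (evalChar ψ b n) k = 0 := by linear_combination -hsum
  exact (mul_eq_zero.1 h4).resolve_left (sub_ne_zero.2 hu)

theorem lPowerSum_evalChar (ψ : MulChar (ZMod p) ℂ) {ι : Type*} [Fintype ι] (b : ι → ZMod p)
    (n : ι → ℕ) (j : ℕ) :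
    lPowerSum (evalChar ψ b n) j = ∑ x : GaloisField p j, ψ (Algebra.norm (ZMod p)
      (aeval x (∏ i, (C (b i) - X) ^ n i))) := by
  refine Finset.sum_congr rfl fun x _ => ?_
  simp [evalChar_apply, eval_minpolyPow, map_prod]

theorem lCoeff_evalChar_one (ψ : MulChar (ZMod p) ℂ) {ι : Type*} [Fintype ι] (b : ι → ZMod p)
    (n : ι → ℕ) : lCoeff (evalChar ψ b n) 1 = ∑ x, ∏ j, ψ (b j - x) ^ n j := by
  rw [lCoeff]
  symm
  refine Finset.sum_bij (fun x _ => X - C x) ?_ ?_ ?_ ?_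
  · exact fun x _ => mem_monicsOfDegree.2 ⟨monic_X_sub_C x, natDegree_X_sub_C x⟩
  · intro x _ y _ h
    simpa using h
  · intro g hg
    rw [mem_monicsOfDegree] at hg
    refine ⟨-g.coeff 0, Finset.mem_univ _, ?_⟩
    rw [C_neg, sub_neg_eq_add]
    exact (hg.1.eq_X_add_C hg.2).symm
  · intro x _
    simp [evalChar_apply]

end newton

/-! ### From growth of power sums to a bound for the linear coefficient -/

section analytic

open Polynomial

/-- At a zero of L the function t L'/L would have a pole, which a bounded G excludes. -/
theorem pole_free_of_deriv_mul_eq {L : ℂ[X]} {G : ℂ → ℂ} {K ρ : ℝ} {t₀ : ℂ} (ht₀ : ‖t₀‖ < ρ)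
    (hG : ∀ t, ‖t‖ < ρ → ‖G t‖ ≤ K)
    (h : ∀ t, ‖t‖ < ρ → t * L.derivative.eval t = L.eval t * G t) (h0 : L.eval 0 ≠ 0) :
    L.eval t₀ ≠ 0 := by
  intro hroot
  have hL : L ≠ 0 := by rintro rfl; simp at h0
  have ht0 : t₀ ≠ 0 := by rintro rfl; exact h0 hroot
  obtain ⟨H, hH, hHnd⟩ := exists_eq_pow_rootMultiplicity_mul_and_not_dvd L hL t₀
  have hH0 : H.eval t₀ ≠ 0 := fun h1 => hHnd (dvd_iff_isRoot.2 h1)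
  have hr : 0 < L.rootMultiplicity t₀ := (rootMultiplicity_pos hL).2 hroot
  obtain ⟨r, hr⟩ := Nat.exists_eq_succ_of_ne_zero hr.ne'
  rw [hr] at hH
  have hev : ∀ᶠ t in 𝓝[≠] t₀, ‖t * ((r + 1) * H.eval t + (t - t₀) * H.derivative.eval t)‖ ≤
      ‖(t - t₀) * H.eval t‖ * K := by
    have h1 : ∀ᶠ t in 𝓝[≠] t₀, ‖t‖ < ρ :=
      (continuous_norm.tendsto t₀).mono_left nhdsWithin_le_nhds |>.eventually (gt_mem_nhds ht₀)
    filter_upwards [h1, self_mem_nhdsWithin] with t ht hne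
    have h2 := h t ht
    have hsub : (t - t₀) ^ r ≠ 0 := pow_ne_zero _ (sub_ne_zero.2 hne)
    have h3 : t * ((r + 1) * H.eval t + (t - t₀) * H.derivative.eval t) =
        (t - t₀) * H.eval t * G t := by
      apply mul_left_cancel₀ hsub
      rw [hH] at h2
      simp only [derivative_mul, derivative_X_sub_C_pow, eval_add, eval_mul, eval_pow, eval_sub,
        eval_X, eval_C, Nat.succ_eq_add_one, Nat.add_sub_cancel, Nat.cast_add,
        Nat.cast_one] at h2
      linear_combination h2
    rw [h3, norm_mul]
    gcongr
    exact hG t ht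
  have hlim1 : Tendsto (fun t : ℂ => ‖t * ((r + 1) * H.eval t + (t - t₀) * H.derivative.eval t)‖)
      (𝓝[≠] t₀) (𝓝 ‖t₀ * ((r + 1) * H.eval t₀ + (t₀ - t₀) * H.derivative.eval t₀)‖) := by
    refine (Continuous.tendsto ?_ t₀).mono_left nhdsWithin_le_nhds
    fun_prop
  have hlim2 : Tendsto (fun t : ℂ => ‖(t - t₀) * H.eval t‖ * K)
      (𝓝[≠] t₀) (𝓝 (‖(t₀ - t₀) * H.eval t₀‖ * K)) := by
    refine (Continuous.tendsto ?_ t₀).mono_left nhdsWithin_le_nhds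
    fun_prop
  have hle := le_of_tendsto_of_tendsto hlim1 hlim2 hev
  simp only [sub_self, zero_mul, add_zero, norm_zero, norm_le_zero_iff, mul_eq_zero] at hle
  rcases hle with h1 | h1 | h1
  · exact ht0 h1
  · exact Nat.cast_add_one_ne_zero r h1
  · exact hH0 h1

/-- If the power sums attached to a polynomial `∑ c k t ^ k` with `c 0 = 1` grow at most like
`R ^ n`, then its linear coefficient is at most its degree times `R`. -/
theorem norm_linear_coeff_le_of_powerSum_le {c S : ℕ → ℂ} {m : ℕ} (hc0 : c 0 = 1)
    (hc : ∀ k, m ≤ k → c k = 0)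
    (hN : ∀ k, ∑ j ∈ Finset.Icc 1 k, S j * c (k - j) = k * c k)
    {C R : ℝ} (hR : 0 < R) (hS : ∀ j, 1 ≤ j → ‖S j‖ ≤ C * R ^ j) : ‖c 1‖ ≤ m * R := by
  set L : ℂ[X] := ∑ k ∈ Finset.range m, monomial k (c k) with hLdef
  have hcoeff : ∀ k, L.coeff k = c k := by
    intro k
    rw [hLdef, finsetSum_coeff]
    simp only [coeff_monomial, Finset.sum_ite_eq', Finset.mem_range]
    split_ifs with h
    · rfl
    · exact (hc k (not_lt.1 h)).symm
  have hdeg : L.natDegree ≤ m :=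
    natDegree_sum_le_of_forall_le _ _ fun k hk =>
      (natDegree_monomial_le _).trans (Finset.mem_range.1 hk).le
  have hL0 : L.eval 0 = 1 := by rw [← coeff_zero_eq_eval_zero, hcoeff, hc0]
  have hC : 0 ≤ C := by
    have := (norm_nonneg _).trans (hS 1 le_rfl)
    rw [pow_one] at this
    exact nonneg_of_mul_nonneg_left this hR
  -- Newton's identities and the growth bound concern only j ≥ 1, so the value at 0 is reset to 0
  -- before forming the generating series.
  let S' : ℕ → ℂ := fun j => if j = 0 then 0 else S j
  have hS' : ∀ j, ‖S' j‖ ≤ C * R ^ j := by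
    intro j
    by_cases hj : j = 0
    · simp only [S', if_pos hj, norm_zero]
      positivity
    · simp only [S', if_neg hj]
      exact hS j (Nat.one_le_iff_ne_zero.2 hj)
  let G : ℂ → ℂ := fun t => ∑' j, S' j * t ^ j
  have hbound : ∀ {t : ℂ} {ρ : ℝ}, ‖t‖ ≤ ρ → ∀ j, ‖S' j * t ^ j‖ ≤ C * (R * ρ) ^ j := by
    intro t ρ ht j
    rw [norm_mul, norm_pow, mul_pow, ← mul_assoc]
    exact mul_le_mul (hS' j) (pow_le_pow_left₀ (norm_nonneg _) ht _) (by positivity)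
      (by positivity)
  have hgeom : ∀ {ρ : ℝ}, 0 ≤ ρ → ρ < R⁻¹ → Summable fun j : ℕ => C * (R * ρ) ^ j := by
    intro ρ h0 h1
    refine (summable_geometric_of_lt_one (by positivity) ?_).mul_left C
    rwa [mul_comm, ← lt_inv_mul_iff₀' hR, mul_one]
  -- The series G converges for |t| < 1/R and satisfies t L' = L G there, by the Cauchy product and
  -- Newton's identities.
  have hroots : ∀ z ∈ L.roots, R⁻¹ ≤ ‖z‖ := by
    intro z hz
    by_contra! hlt
    obtain ⟨ρ, hzρ, hρR⟩ := exists_between hlt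
    have hρ0 : 0 ≤ ρ := (norm_nonneg z).trans hzρ.le
    refine pole_free_of_deriv_mul_eq (L := L) (G := G) (K := ∑' j : ℕ, C * (R * ρ) ^ j) hzρ ?_ ?_
      (by rw [hL0]; exact one_ne_zero) (isRoot_of_mem_roots hz)
    · intro t ht
      exact tsum_of_norm_bounded (hgeom hρ0 hρR).hasSum (hbound ht.le)
    · intro t ht
      have hsumG : Summable fun j => ‖S' j * t ^ j‖ :=
        (hgeom hρ0 hρR).of_nonneg_of_le (fun _ => norm_nonneg _) (hbound ht.le)
      have hfin : ∀ k ∉ Finset.range m, c k * t ^ k = 0 := by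
        intro k hk
        rw [hc k (by simpa using hk), zero_mul]
      have hsumL : Summable fun k => ‖c k * t ^ k‖ :=
        summable_of_ne_finset_zero (s := Finset.range m) fun k hk => by
          rw [hfin k hk, norm_zero]
      have hevL : L.eval t = ∑' k, c k * t ^ k := by
        rw [tsum_eq_sum hfin, hLdef, eval_finsetSum]
        simp
      have hL' : t * L.derivative.eval t = ∑' k : ℕ, (k * c k) * t ^ k := by
        rw [tsum_eq_sum (s := Finset.range m) (fun k hk => by
          rw [hc k (by simpa using hk)]; simp), hLdef, derivative_sum, eval_finsetSum,
          Finset.mul_sum]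
        refine Finset.sum_congr rfl fun k _ => ?_
        rw [derivative_monomial, eval_monomial]
        rcases k with _ | k
        · simp
        · rw [Nat.add_sub_cancel]
          ring
      rw [hevL, hL', tsum_mul_tsum_eq_tsum_sum_antidiagonal_of_summable_norm hsumL hsumG]
      refine tsum_congr fun k => ?_
      rw [← hN k, Finset.sum_mul, ← Finset.Nat.sum_antidiagonal_swap,
        Finset.Nat.sum_antidiagonal_eq_sum_range_succ_mk]
      refine Finset.sum_subset_zero_on_sdiff (fun j hj => ?_) (fun j hj => ?_) fun j hj => ?_
      · rw [Finset.mem_Icc] at hj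
        exact Finset.mem_range.2 (by omega)
      · rw [Finset.mem_sdiff, Finset.mem_range, Finset.mem_Icc] at hj
        simp [S', show j = 0 by omega]
      · rw [Finset.mem_Icc] at hj
        have h2 : t ^ k = t ^ (k - j) * t ^ j := by rw [← pow_add]; congr 1; omega
        simp only [S', Prod.swap_prod_mk, if_neg (show j ≠ 0 by omega), h2]
        ring
  -- Since L(0) = 1, the linear coefficient is the logarithmic derivative at 0, namely minus the sum
  -- of the inverse roots.
  have h1 : c 1 = (L.roots.map fun z => 1 / (0 - z)).sum := by
    rw [← (IsAlgClosed.splits L).eval_derivative_div_eval_of_ne_zero (x := 0)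
      (by rw [hL0]; exact one_ne_zero), hL0, div_one, ← coeff_zero_eq_eval_zero, coeff_derivative,
      hcoeff]
    simp
  rw [h1]
  refine (norm_multiset_sum_le _).trans ?_
  rw [Multiset.map_map]
  refine (Multiset.sum_le_card_nsmul _ R ?_).trans ?_
  · intro y hy
    obtain ⟨z, hz, rfl⟩ := Multiset.mem_map.1 hy
    rw [Function.comp_apply, zero_sub, norm_div, norm_one, norm_neg, one_div]
    exact inv_le_of_inv_le₀ hR (hroots z hz)
  · rw [Multiset.card_map, nsmul_eq_mul]
    gcongr
    exact (card_roots' L).trans hdeg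

end analytic

/-! ### Weil's bound for complete character sums -/

section weil

open Polynomial

/-- With ℓ = ⌊√Q⌋ and J = ⌊ℓ/d⌋ + 2m + 6 one has dJ ≥ ℓ + (2m+5)d. The surplus (2m+5)ds exceeds
(m+2)Q, which bounds ℓ(ℓm + J). -/
theorem stepanov_parameters {m d s Q : ℕ} (hd : 1 ≤ d) (hQ : Q = d * s + 1)
    (hbig : (2 * m + 6) ^ 2 ≤ Q) :
    Nat.sqrt Q * (s + Nat.sqrt Q * m + (Nat.sqrt Q / d + (2 * m + 6))) <
      d * (Nat.sqrt Q / d + (2 * m + 6)) * s := by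
  have h1 : Nat.sqrt Q * Nat.sqrt Q ≤ Q := Nat.sqrt_le Q
  have h2 : 2 * m + 6 ≤ Nat.sqrt Q := by
    rw [Nat.le_sqrt, ← sq]
    exact hbig
  set ℓ := Nat.sqrt Q
  have h3 : ℓ ≤ d * (ℓ / d) + d := by
    have := Nat.div_add_mod ℓ d
    have := Nat.mod_lt ℓ (show d > 0 by omega)
    omega
  have h4 : ℓ / d + (2 * m + 6) ≤ 2 * ℓ := by
    have := Nat.div_le_self ℓ d
    omega
  have h5 : ℓ + (2 * m + 5) * d ≤ d * (ℓ / d + (2 * m + 6)) := by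
    rw [mul_add]
    have : d * (2 * m + 6) = (2 * m + 5) * d + d := by ring
    omega
  calc ℓ * (s + ℓ * m + (ℓ / d + (2 * m + 6)))
      ≤ ℓ * (s + ℓ * m + 2 * ℓ) := by gcongr
    _ = ℓ * s + (m + 2) * (ℓ * ℓ) := by ring
    _ ≤ ℓ * s + (m + 2) * Q := by gcongr
    _ < ℓ * s + (2 * m + 5) * (d * s) := by
        have h6 : 4 ≤ d * s := by nlinarith
        rw [hQ]
        nlinarith
    _ = (ℓ + (2 * m + 5) * d) * s := by ring
    _ ≤ d * (ℓ / d + (2 * m + 6)) * s := by gcongr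

theorem card_pow_eval_eq_le {E : Type*} [Field E] [Fintype E] [DecidableEq E]
    (h : E[X]) (h0 : h.coeff 0 ≠ 0) {d s : ℕ} (hd : 1 ≤ d)
    (hcard : Fintype.card E = d * s + 1) {a : E} (ha : a ≠ 0) :
    ((Finset.univ.filter fun x : E => (X * h).eval x ^ s = a).card : ℝ) ≤
      (Fintype.card E : ℝ) / d + (6 * (X * h).natDegree + 12) * √(Fintype.card E) := by
  set m := (X * h).natDegree
  set Q := Fintype.card E
  set N := (Finset.univ.filter fun x : E => (X * h).eval x ^ s = a).card with hN
  have hd0 : (0 : ℝ) < d := by exact_mod_cast hd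
  by_cases hbig : (2 * m + 6) ^ 2 ≤ Q
  · have hJ := stepanov_parameters hd hcard hbig
    have hst : N * Nat.sqrt Q ≤ (m + (Nat.sqrt Q / d + (2 * m + 6))) * Q :=
      stepanov_card_le h h0 hcard ha (Nat.sqrt_le_self _) hJ
    have hℓ2 : 2 * m + 6 ≤ Nat.sqrt Q := by
      rw [Nat.le_sqrt, ← sq]
      exact hbig
    have hQlt : Q < (Nat.sqrt Q + 1) * (Nat.sqrt Q + 1) := Nat.lt_succ_sqrt Q
    set ℓ := Nat.sqrt Q
    have hℓ : (0 : ℝ) < ℓ := by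
      have : 0 < ℓ := by omega
      exact_mod_cast this
    have hsq : √(Q : ℝ) ≤ 2 * ℓ := by
      rw [Real.sqrt_le_left (by positivity)]
      have h1 : (ℓ + 1) * (ℓ + 1) ≤ (2 * ℓ) * (2 * ℓ) := Nat.mul_self_le_mul_self (by omega)
      have h2 : Q ≤ (2 * ℓ) * (2 * ℓ) := by omega
      rw [sq]
      exact_mod_cast h2
    have hQℓ : (Q : ℝ) ≤ 2 * √(Q : ℝ) * ℓ := by
      nlinarith [Real.mul_self_sqrt (Nat.cast_nonneg (α := ℝ) Q), Real.sqrt_nonneg (Q : ℝ)]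
    have hJle : ((ℓ / d + (2 * m + 6) : ℕ) : ℝ) ≤ ℓ / d + (2 * m + 6) := by
      push_cast
      gcongr
      exact Nat.cast_div_le
    have hst' : (N : ℝ) * ℓ ≤ (m + (ℓ / d + (2 * m + 6))) * Q := by
      have h1 := (Nat.cast_le (α := ℝ)).2 hst
      rw [Nat.cast_mul, Nat.cast_mul, Nat.cast_add] at h1
      refine h1.trans ?_
      gcongr
    refine le_of_mul_le_mul_right (hst'.trans ?_) hℓ
    calc ((m : ℝ) + (ℓ / d + (2 * m + 6))) * Q = Q / d * ℓ + (3 * m + 6) * Q := by ring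
      _ ≤ Q / d * ℓ + (3 * m + 6) * (2 * √(Q : ℝ) * ℓ) := by gcongr
      _ = _ := by ring
  -- For small Q the trivial count N ≤ Q is already at most (2m+6)√Q.
  · have h1 : (N : ℝ) ≤ Q := by
      exact_mod_cast Finset.card_le_univ _
    have h2 : √(Q : ℝ) ≤ 2 * m + 6 := by
      rw [Real.sqrt_le_left (by positivity)]
      exact_mod_cast (not_le.1 hbig).le
    have h3 : (Q : ℝ) ≤ (2 * m + 6) * √(Q : ℝ) := by
      nlinarith [Real.mul_self_sqrt (Nat.cast_nonneg (α := ℝ) Q), Real.sqrt_nonneg (Q : ℝ)]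
    have h4 : (0 : ℝ) ≤ Q / d := by positivity
    nlinarith [Real.sqrt_nonneg (Q : ℝ), Nat.cast_nonneg (α := ℝ) m]

/-- One-sided bounds suffice: the weights sum to 0, so A may be subtracted from each N a, and t ≤ K
gives |t| ≤ 2K - t, whose sum is controlled by the total. -/
theorem norm_sum_mul_le_of_le {α : Type*} (s : Finset α) (w : α → ℂ) (N : α → ℝ) {A K Z : ℝ}
    (hK : 0 ≤ K) (hw : ∀ a ∈ s, ‖w a‖ ≤ 1) (hw0 : ∑ a ∈ s, w a = 0) (hN : ∀ a ∈ s, N a ≤ A + K)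
    (hsum : s.card * A ≤ ∑ a ∈ s, N a + Z) :
    ‖∑ a ∈ s, w a * N a‖ ≤ 2 * s.card * K + Z := by
  have h1 : ∑ a ∈ s, w a * N a = ∑ a ∈ s, w a * ((N a - A : ℝ) : ℂ) := by
    simp only [Complex.ofReal_sub, mul_sub, Finset.sum_sub_distrib, ← Finset.sum_mul, hw0,
      zero_mul, sub_zero]
  rw [h1]
  calc ‖∑ a ∈ s, w a * ((N a - A : ℝ) : ℂ)‖ ≤ ∑ a ∈ s, (2 * K - (N a - A)) := by
        refine norm_sum_le_of_le _ fun a ha => ?_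
        rw [norm_mul, Complex.norm_real, Real.norm_eq_abs]
        have h2 : |N a - A| ≤ 2 * K - (N a - A) := by
          rw [abs_le]
          constructor <;> linarith [hN a ha]
        exact (mul_le_of_le_one_left (abs_nonneg _) (hw a ha)).trans h2
    _ = 2 * s.card * K - ∑ a ∈ s, N a + s.card * A := by
        rw [Finset.sum_sub_distrib, Finset.sum_sub_distrib]
        simp only [Finset.sum_const, nsmul_eq_mul]
        ring
    _ ≤ 2 * s.card * K + Z := by linarith

/-- The norm is y ↦ y^s with s = (|E| - 1)/(p - 1), so its fibres are Stepanov's equations with d =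
p - 1. The factor p in the bound is harmless: only the growth in |E| is used later. -/
theorem norm_sum_mulChar_norm_eval_le {p : ℕ} [Fact p.Prime] {E : Type*} [Field E] [Fintype E]
    [Algebra (ZMod p) E] {ψ : MulChar (ZMod p) ℂ} (hψ : ψ ≠ 1) (h : E[X]) (h0 : h.coeff 0 ≠ 0) :
    ‖∑ x : E, ψ (Algebra.norm (ZMod p) ((X * h).eval x))‖ ≤
      (2 * p * (6 * (X * h).natDegree + 12) + (X * h).natDegree) * √(Fintype.card E) := by
  classical
  set f := X * h with hf
  have hp : p.Prime := Fact.out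
  have hcardE : Fintype.card E = p ^ Module.finrank (ZMod p) E := by
    rw [Module.card_eq_pow_finrank (K := ZMod p), ZMod.card]
  set s := (Fintype.card E - 1) / (p - 1) with hs
  have hcard : Fintype.card E = (p - 1) * s + 1 := by
    have h1 : p - 1 ∣ Fintype.card E - 1 := by
      rw [hcardE]
      simpa using Nat.sub_dvd_pow_sub_pow p 1 (Module.finrank (ZMod p) E)
    rw [hs, Nat.mul_div_cancel' h1]
    have := Fintype.card_pos (α := E)
    omega
  have hd : 1 ≤ p - 1 := by have := hp.two_le; omega
  have hnorm : ∀ y : E, algebraMap (ZMod p) E (Algebra.norm (ZMod p) y) = y ^ s := by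
    intro y
    rw [FiniteField.algebraMap_norm_eq_pow, Nat.card_eq_fintype_card, Nat.card_zmod]
  set Q : ℝ := (Fintype.card E : ℝ) with hQ
  have hQ1 : 1 ≤ √Q := by
    rw [Real.one_le_sqrt, hQ]
    exact_mod_cast Fintype.card_pos (α := E)
  let N : ZMod p → ℝ := fun a =>
    ((Finset.univ.filter fun x : E => Algebra.norm (ZMod p) (f.eval x) = a).card : ℝ)
  have hN : ∀ a ∈ Finset.univ.erase (0 : ZMod p),
      N a ≤ Q / (p - 1 : ℕ) + (6 * f.natDegree + 12) * √Q := by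
    intro a ha
    have ha' : algebraMap (ZMod p) E a ≠ 0 :=
      (_root_.map_ne_zero (algebraMap (ZMod p) E)).2 (Finset.ne_of_mem_erase ha)
    refine le_trans (le_of_eq ?_) (card_pow_eval_eq_le h h0 hd hcard ha')
    simp only [N, ← hnorm, (algebraMap (ZMod p) E).injective.eq_iff, hf]
  have hfib : ∑ x : E, ψ (Algebra.norm (ZMod p) (f.eval x)) =
      ∑ a ∈ Finset.univ.erase (0 : ZMod p), ψ a * N a := by
    rw [← Finset.sum_fiberwise (s := Finset.univ)
      (g := fun x : E => Algebra.norm (ZMod p) (f.eval x)),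
      ← Finset.sum_erase Finset.univ (a := (0 : ZMod p))]
    · refine Finset.sum_congr rfl fun a _ => ?_
      rw [Finset.sum_congr rfl fun x hx => by rw [(Finset.mem_filter.1 hx).2], Finset.sum_const,
        nsmul_eq_mul, mul_comm]
      simp [N]
    · refine Finset.sum_eq_zero fun x hx => ?_
      rw [(Finset.mem_filter.1 hx).2, MulChar.map_zero]
  have hm : 1 ≤ f.natDegree := by
    rw [hf, natDegree_X_mul]
    · omega
    · rintro rfl
      simp at h0
  have hf0 : f ≠ 0 := by
    intro h1
    rw [h1, natDegree_zero] at hm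
    omega
  have hcardSum : Q ≤ ∑ a ∈ Finset.univ.erase (0 : ZMod p), N a + f.natDegree := by
    have h1 : ∑ a, N a = Q := by
      have := Finset.card_eq_sum_card_fiberwise (s := (Finset.univ : Finset E))
        (t := (Finset.univ : Finset (ZMod p)))
        (f := fun x : E => Algebra.norm (ZMod p) (f.eval x)) (fun _ _ => by simp)
      rw [hQ, ← Finset.card_univ, this]
      push_cast
      rfl
    have h2 : N 0 ≤ f.natDegree := by
      have h3 : (Finset.univ.filter fun x : E => Algebra.norm (ZMod p) (f.eval x) = 0) ⊆
          f.roots.toFinset := by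
        intro x hx
        rw [Finset.mem_filter, Algebra.norm_eq_zero_iff] at hx
        rw [Multiset.mem_toFinset, mem_roots hf0]
        exact hx.2
      exact Nat.cast_le.2 <| (Finset.card_le_card h3).trans
        ((Multiset.toFinset_card_le _).trans (card_roots' f))
    rw [← h1, ← Finset.add_sum_erase _ _ (Finset.mem_univ (0 : ZMod p))]
    linarith
  have hcardS : (Finset.univ.erase (0 : ZMod p)).card = p - 1 := by
    rw [Finset.card_erase_of_mem (Finset.mem_univ _), Finset.card_univ, ZMod.card]
  rw [hfib]
  refine (norm_sum_mul_le_of_le _ _ N (A := Q / (p - 1 : ℕ))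
    (K := (6 * f.natDegree + 12) * √Q) (Z := f.natDegree) (by positivity)
    (fun a _ => DirichletCharacter.norm_le_one ψ a) ?_ hN ?_).trans ?_
  · rw [Finset.sum_erase _ (MulChar.map_zero ψ), MulChar.sum_eq_zero_of_ne_one hψ]
  · rw [hcardS, mul_div_cancel₀]
    · exact hcardSum
    · exact_mod_cast (by omega : p - 1 ≠ 0)
  · rw [hcardS]
    have h1 : ((p - 1 : ℕ) : ℝ) ≤ p := by exact_mod_cast Nat.sub_le p 1
    calc 2 * ((p - 1 : ℕ) : ℝ) * ((6 * f.natDegree + 12) * √Q) + f.natDegree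
        ≤ 2 * p * ((6 * f.natDegree + 12) * √Q) + f.natDegree * √Q := by
          gcongr
          exact le_mul_of_one_le_right (by positivity) hQ1
      _ = _ := by ring

/-- Weil's bound for a multiplicative character sum over `ZMod p`, for a product of linear
factors one of which is simple. -/
theorem norm_sum_prod_mulChar_pow_le {p : ℕ} [Fact p.Prime] {ψ : MulChar (ZMod p) ℂ}
    (hψ : ψ ≠ 1) {ι : Type*} [Fintype ι] (b : ι → ZMod p) (n : ι → ℕ) (j₀ : ι) (hn : n j₀ = 1)
    (hb : ∀ j, j ≠ j₀ → b j ≠ b j₀) :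
    ‖∑ x, ∏ j, ψ (b j - x) ^ n j‖ ≤ Fintype.card ι * √p := by
  classical
  -- A translation moves the simple root to 0, as Stepanov's argument requires.
  wlog hb0 : b j₀ = 0 generalizing b
  · have h1 := this (fun j => b j - b j₀) (fun j hj => by
      simpa [sub_eq_zero] using hb j hj) (sub_self _)
    rw [← (Equiv.subRight (b j₀)).sum_comp] at h1
    simpa using h1
  have hp : p.Prime := Fact.out
  set H : (ZMod p)[X] := -∏ j ∈ Finset.univ.erase j₀, (C (b j) - X) ^ n j with hH
  have hprod : ∏ j, (C (b j) - X) ^ n j = X * H := by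
    rw [← Finset.mul_prod_erase _ _ (Finset.mem_univ j₀), hn, hb0, hH]
    simp
  have hH0 : H.coeff 0 ≠ 0 := by
    rw [coeff_zero_eq_eval_zero, hH, eval_neg, eval_prod, neg_ne_zero, Finset.prod_ne_zero_iff]
    intro j hj
    have := hb j (Finset.ne_of_mem_erase hj)
    rw [hb0] at this
    simpa using fun h => absurd h this
  rw [← lCoeff_evalChar_one]
  -- The constant C is the same for all extensions, since base change preserves the degree of X * H.
  -- It disappears from the conclusion, leaving R = √p.
  refine norm_linear_coeff_le_of_powerSum_le (S := lPowerSum (evalChar ψ b n))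
    (C := 2 * p * (6 * (X * H).natDegree + 12) + (X * H).natDegree) (lCoeff_zero _)
    (fun k hk => lCoeff_evalChar_eq_zero hψ hn hb hk) (sum_lPowerSum_mul_lCoeff _)
    (Real.sqrt_pos.2 (by exact_mod_cast hp.pos)) fun j hj => ?_
  rw [lPowerSum_evalChar, hprod]
  have h1 := norm_sum_mulChar_norm_eval_le (E := GaloisField p j) hψ
    (H.map (algebraMap (ZMod p) (GaloisField p j))) (by
      rw [coeff_map]
      exact (_root_.map_ne_zero _).2 hH0)
  have h2 : X * H.map (algebraMap (ZMod p) (GaloisField p j)) =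
      (X * H).map (algebraMap (ZMod p) (GaloisField p j)) := by simp
  have h3 : √((Fintype.card (GaloisField p j) : ℕ) : ℝ) = √(p : ℝ) ^ j := by
    rw [← Nat.card_eq_fintype_card, GaloisField.card p j (by omega), Nat.cast_pow,
      Real.sqrt_eq_iff_mul_self_eq (by positivity) (by positivity), ← mul_pow,
      Real.mul_self_sqrt (by positivity)]
  rw [h2, h3, natDegree_map] at h1
  simpa only [eval_map_algebraMap] using h1

end weil

/-! ### Moments of short character sums -/

section moment

/-- If every value is repeated, at most l values occur, so β factors through `Fin l`. -/
theorem card_piFinset_filter_repeated_le {ι α : Type*} [Fintype ι] [DecidableEq ι] [Nonempty ι]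
    [DecidableEq α] (T : Finset α) {l : ℕ} (hl : Fintype.card ι = 2 * l) :
    ((Fintype.piFinset fun _ : ι => T).filter fun β => ∀ i, ∃ j, j ≠ i ∧ β j = β i).card ≤
      T.card ^ l * l ^ (2 * l) := by
  classical
  have hsub : ((Fintype.piFinset fun _ : ι => T).filter fun β => ∀ i, ∃ j, j ≠ i ∧ β j = β i) ⊆
      ((Fintype.piFinset fun _ : Fin l => T) ×ˢ (Finset.univ : Finset (ι → Fin l))).image
        fun z => z.1 ∘ z.2 := by
    intro β hβ
    rw [Finset.mem_filter, Fintype.mem_piFinset] at hβ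
    obtain ⟨hT, hrep⟩ := hβ
    set s := Finset.univ.image β with hs
    have hcard : s.card ≤ l := by
      have h1 : 2 * s.card ≤ (Finset.univ : Finset ι).card := by
        refine Finset.mul_card_image_le_card_of_maps_to (s := Finset.univ) (f := β)
          (fun i hi => Finset.mem_image_of_mem _ hi) 2 fun a ha => ?_
        obtain ⟨i, -, rfl⟩ := Finset.mem_image.1 ha
        obtain ⟨j, hj, hij⟩ := hrep i
        refine Finset.one_lt_card.2 ⟨i, by simp, j, by simp [hij], hj.symm⟩
      rw [Finset.card_univ, hl] at h1
      omega
    let u : Fin l → α := fun i => if h : (i : ℕ) < s.card then (s.equivFin.symm ⟨i, h⟩ : α) else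
      β (Classical.arbitrary ι)
    let v : ι → Fin l := fun j =>
      Fin.castLE hcard (s.equivFin ⟨β j, Finset.mem_image_of_mem _ (Finset.mem_univ j)⟩)
    refine Finset.mem_image.2 ⟨(u, v), Finset.mem_product.2 ⟨?_, Finset.mem_univ _⟩, ?_⟩
    · rw [Fintype.mem_piFinset]
      intro i
      simp only [u]
      split_ifs with h
      · obtain ⟨j, -, hj⟩ := Finset.mem_image.1 (s.equivFin.symm ⟨i, h⟩).2
        rw [← hj]
        exact hT j
      · exact hT _
    · ext j
      simp [u, v]
  refine (Finset.card_le_card hsub).trans (Finset.card_image_le.trans (le_of_eq ?_))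
  rw [Finset.card_product, Fintype.card_piFinset_const, Finset.card_univ, Fintype.card_fun, hl,
    Fintype.card_fin]

variable {p : ℕ} [Fact p.Prime]

theorem exists_pow_eq_mulChar_inv (ψ : MulChar (ZMod p) ℂ) :
    ∃ m : ℕ, ∀ y, ψ⁻¹ y = ψ y ^ m := by
  have h1 : ψ ^ (2 * Fintype.card (ZMod p)ˣ - 1 + 1) = 1 := by
    rw [Nat.sub_add_cancel (by have := Fintype.card_pos (α := (ZMod p)ˣ); omega), mul_comm, pow_mul,
      MulChar.pow_card_eq_one, one_pow]
  -- The factor 2 keeps the exponent positive even for p = 2, so that the identity also holds at y =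
  -- 0.
  refine ⟨2 * Fintype.card (ZMod p)ˣ - 1, fun y => ?_⟩
  rw [← MulChar.pow_apply' ψ (by have := Fintype.card_pos (α := (ZMod p)ˣ); omega)]
  congr 1
  exact inv_eq_of_mul_eq_one_left (by rw [← pow_succ, h1])

theorem norm_sum_prod_mulChar_le {χ : MulChar (ZMod p) ℂ} (hχ : χ ≠ 1) {ι : Type*} [Fintype ι]
    (φ : ι → MulChar (ZMod p) ℂ) (hφ : ∀ i, φ i = χ ∨ φ i = χ⁻¹) (b : ι → ZMod p) (i₀ : ι)
    (hb : ∀ j, j ≠ i₀ → b j ≠ b i₀) :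
    ‖∑ x, ∏ j, φ j (b j - x)‖ ≤ Fintype.card ι * √p := by
  classical
  obtain ⟨m, hm⟩ := exists_pow_eq_mulChar_inv (φ i₀)
  have hψ : φ i₀ ≠ 1 := by
    rcases hφ i₀ with h | h <;> rw [h]
    · exact hχ
    · exact inv_ne_one.2 hχ
  have h1 : ∀ x j, φ j (b j - x) = φ i₀ (b j - x) ^ (if φ j = φ i₀ then 1 else m) := by
    intro x j
    split_ifs with h
    · rw [h, pow_one]
    · rw [← hm]
      congr 1
      rcases hφ j with h2 | h2 <;> rcases hφ i₀ with h3 | h3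
      · exact absurd (h2.trans h3.symm) h
      · rw [h2, h3, inv_inv]
      · rw [h2, h3]
      · exact absurd (h2.trans h3.symm) h
  rw [Finset.sum_congr rfl fun x _ => Finset.prod_congr rfl fun j _ => h1 x j]
  exact norm_sum_prod_mulChar_pow_le hψ b (fun j => if φ j = φ i₀ then 1 else m) i₀ (if_pos rfl) hb

/-- Expand into 2l-tuples. Tuples with every entry repeated are few and are bounded trivially by p;
any other has an entry occurring once, still isolated modulo p as k < p, and Weil's bound gives
2l√p. -/
theorem sum_norm_pow_le {χ : DirichletCharacter ℂ p} (hχ : χ ≠ 1) {l k : ℕ}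
    (hl : 1 ≤ l) (hk : k < p) :
    ∑ x : ZMod p, ‖∑ b ∈ Finset.Icc 1 k, χ (x + b)‖ ^ (2 * l) ≤
      l ^ (2 * l) * k ^ l * p + 2 * l * k ^ (2 * l) * √p := by
  classical
  have : Nonempty (Fin l ⊕ Fin l) := ⟨Sum.inl ⟨0, hl⟩⟩
  set T := Finset.Icc 1 k with hT
  have hTcard : T.card = k := by simp [hT]
  let φ : Fin l ⊕ Fin l → MulChar (ZMod p) ℂ := Sum.elim (fun _ => χ) (fun _ => χ⁻¹)
  have hφ : ∀ i, φ i = χ ∨ φ i = χ⁻¹ := by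
    rintro (i | i)
    · exact Or.inl rfl
    · exact Or.inr rfl
  set Ω := Fintype.piFinset fun _ : Fin l ⊕ Fin l => T with hΩ
  have hpow : ∀ x : ZMod p, ((‖∑ b ∈ T, χ (-x + b)‖ ^ (2 * l) : ℝ) : ℂ) =
      ∑ β ∈ Ω, ∏ j, φ j ((β j : ZMod p) - x) := by
    intro x
    rw [hΩ, ← Finset.prod_univ_sum (fun _ : Fin l ⊕ Fin l => T)
      (fun j (b : ℕ) => φ j ((b : ZMod p) - x)), Fintype.prod_sum_type]
    simp only [φ, Sum.elim_inl, Sum.elim_inr, Finset.prod_const, Finset.card_univ,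
      Fintype.card_fin, neg_add_eq_sub, ← MulChar.star_apply']
    rw [← star_sum, ← mul_pow, Complex.ofReal_pow, pow_mul, ← Complex.mul_conj']
    rfl
  have hcast : ∑ x : ZMod p, ‖∑ b ∈ T, χ (x + b)‖ ^ (2 * l) =
      ‖∑ β ∈ Ω, ∑ x : ZMod p, ∏ j, φ j ((β j : ZMod p) - x)‖ := by
    rw [Finset.sum_comm, ← Equiv.sum_comp (Equiv.neg (ZMod p))]
    rw [Finset.sum_congr rfl fun x _ => (hpow x).symm, ← Complex.ofReal_sum,
      Complex.norm_real, Real.norm_of_nonneg]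
    · rfl
    · exact Finset.sum_nonneg fun _ _ => by positivity
  rw [hcast]
  have htriv : ∀ β : Fin l ⊕ Fin l → ℕ,
      ‖∑ x : ZMod p, ∏ j, φ j ((β j : ZMod p) - x)‖ ≤ p := by
    intro β
    refine (norm_sum_le_of_le _ (n := fun _ => (1 : ℝ)) fun x _ => ?_).trans (by simp)
    rw [norm_prod]
    exact Finset.prod_le_one (fun _ _ => norm_nonneg _)
      fun j _ => DirichletCharacter.norm_le_one (φ j) _
  have hcardι : Fintype.card (Fin l ⊕ Fin l) = 2 * l := by simp [two_mul]
  rw [← Finset.sum_filter_add_sum_filter_not Ω (fun β => ∀ i, ∃ j, j ≠ i ∧ β j = β i)]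
  refine (norm_add_le _ _).trans (add_le_add ?_ ?_)
  · refine (norm_sum_le_of_le _ fun β _ => htriv β).trans ?_
    rw [Finset.sum_const, nsmul_eq_mul]
    gcongr
    have := card_piFinset_filter_repeated_le T hcardι
    rw [hTcard, mul_comm] at this
    exact_mod_cast this
  · have hgood : ∀ β ∈ Ω.filter (fun β => ¬ ∀ i, ∃ j, j ≠ i ∧ β j = β i),
        ‖∑ x : ZMod p, ∏ j, φ j ((β j : ZMod p) - x)‖ ≤ 2 * l * √p := by
      intro β hβ
      rw [Finset.mem_filter, hΩ, Fintype.mem_piFinset] at hβ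
      obtain ⟨hβT, hβ⟩ := hβ
      push Not at hβ
      obtain ⟨i, hi⟩ := hβ
      have h1 := norm_sum_prod_mulChar_le hχ φ hφ (fun j => (β j : ZMod p)) i fun j hj h => by
        have hj1 := hβT j
        have hi1 := hβT i
        rw [hT, Finset.mem_Icc] at hj1 hi1
        rw [ZMod.natCast_eq_natCast_iff', Nat.mod_eq_of_lt (by omega),
          Nat.mod_eq_of_lt (by omega)] at h
        exact hi j hj h
      rw [hcardι] at h1
      exact_mod_cast h1
    refine (norm_sum_le_of_le _ hgood).trans ?_
    rw [Finset.sum_const, nsmul_eq_mul]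
    have h2 : (Ω.filter (fun β => ¬ ∀ i, ∃ j, j ≠ i ∧ β j = β i)).card ≤ k ^ (2 * l) := by
      refine (Finset.card_filter_le _ _).trans (le_of_eq ?_)
      rw [hΩ, Fintype.card_piFinset, Finset.prod_const, hTcard, Finset.card_univ, hcardι]
    calc _ ≤ ((k ^ (2 * l) : ℕ) : ℝ) * (2 * l * √p) := by gcongr
      _ = _ := by push_cast; ring

end moment

/-! ### Burgess's amplification by shifts -/

section burgess

/-- Power means over P, then Cauchy–Schwarz over the fibres of f, whose squared sizes add up to the
number of collisions. -/
theorem sum_comp_pow_le {α β : Type*} [Fintype β] [DecidableEq α] [DecidableEq β] (P : Finset α)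
    (f : α → β) (F : β → ℝ) (hF : ∀ x, 0 ≤ F x) {l : ℕ} (hl : 1 ≤ l) :
    (∑ z ∈ P, F (f z)) ^ (2 * l) ≤ (P.card : ℝ) ^ (2 * (l - 1)) *
      ((P ×ˢ P).filter fun z => f z.1 = f z.2).card * ∑ x, F x ^ (2 * l) := by
  have h1 : (∑ z ∈ P, F (f z)) ^ l ≤ (P.card : ℝ) ^ (l - 1) * ∑ z ∈ P, F (f z) ^ l := by
    obtain ⟨k, rfl⟩ := Nat.exists_eq_add_of_le' hl
    exact pow_sum_le_card_mul_sum_pow (fun z _ => hF _) k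
  have h2 : ∑ z ∈ P, F (f z) ^ l = ∑ x, ((P.filter fun z => f z = x).card : ℝ) * F x ^ l := by
    rw [← Finset.sum_fiberwise (s := P) (g := f)]
    refine Finset.sum_congr rfl fun x _ => ?_
    rw [Finset.sum_congr rfl fun z hz => by rw [(Finset.mem_filter.1 hz).2], Finset.sum_const,
      nsmul_eq_mul]
  have h3 : (((P ×ˢ P).filter fun z => f z.1 = f z.2).card : ℝ) =
      ∑ x, ((P.filter fun z => f z = x).card : ℝ) ^ 2 := by
    rw [Finset.card_eq_sum_card_fiberwise (f := fun z : α × α => f z.1)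
      (t := (Finset.univ : Finset β)) (fun _ _ => by simp)]
    push_cast
    refine Finset.sum_congr rfl fun x _ => ?_
    rw [sq, ← Nat.cast_mul, ← Finset.card_product]
    congr 2
    ext z
    simp only [Finset.mem_filter, Finset.mem_product]
    constructor
    · rintro ⟨⟨⟨h1, h2⟩, h3⟩, rfl⟩
      exact ⟨⟨h1, rfl⟩, h2, h3.symm⟩
    · rintro ⟨⟨h1, h2⟩, h3, h4⟩
      exact ⟨⟨⟨h1, h3⟩, h2.trans h4.symm⟩, h2⟩
  calc (∑ z ∈ P, F (f z)) ^ (2 * l) = ((∑ z ∈ P, F (f z)) ^ l) ^ 2 := by rw [← pow_mul, mul_comm]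
    _ ≤ ((P.card : ℝ) ^ (l - 1) * ∑ z ∈ P, F (f z) ^ l) ^ 2 := by
        have : 0 ≤ ∑ z ∈ P, F (f z) := Finset.sum_nonneg fun z _ => hF _
        gcongr
    _ = (P.card : ℝ) ^ (2 * (l - 1)) *
          (∑ x, ((P.filter fun z => f z = x).card : ℝ) * F x ^ l) ^ 2 := by
        rw [h2, mul_pow, ← pow_mul, mul_comm (l - 1)]
    _ ≤ (P.card : ℝ) ^ (2 * (l - 1)) *
          ((∑ x, ((P.filter fun z => f z = x).card : ℝ) ^ 2) * ∑ x, (F x ^ l) ^ 2) := by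
        gcongr
        exact Finset.sum_mul_sq_le_sq_mul_sq _ _ _
    _ = _ := by
        rw [h3, mul_assoc]
        simp only [← pow_mul, mul_comm l]

/-- Write a = αg, a' = α'g with α, α' coprime; then n = αt, n' = α't. For given g, α there are at
most A/g choices of α' and M/α of t, whence two harmonic sums. -/
theorem card_mul_eq_mul_le (A M : ℕ) :
    ((((Finset.Icc 1 A ×ˢ Finset.Icc 1 M) ×ˢ (Finset.Icc 1 A ×ˢ Finset.Icc 1 M)).filter
      fun z => z.1.2 * z.2.1 = z.2.2 * z.1.1).card : ℝ) ≤ A * M * (1 + Real.log A) ^ 2 := by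
  have h1 : (((Finset.Icc 1 A ×ˢ Finset.Icc 1 M) ×ˢ (Finset.Icc 1 A ×ˢ Finset.Icc 1 M)).filter
      fun z => z.1.2 * z.2.1 = z.2.2 * z.1.1).card ≤
      ((Finset.Icc 1 A ×ˢ Finset.Icc 1 A).sigma
        fun w => Finset.Icc 1 (A / w.1) ×ˢ Finset.Icc 1 (M / w.2)).card := by
    refine Finset.card_le_card_of_surjOn
      (fun y => ((y.1.1 * y.1.2, y.2.2 * y.1.2), (y.1.1 * y.2.1, y.2.2 * y.2.1))) ?_
    rintro ⟨⟨a, n⟩, ⟨a', n'⟩⟩ hz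
    simp only [Finset.coe_filter, Finset.mem_product, Finset.mem_Icc, Set.mem_ofPred_eq] at hz
    obtain ⟨⟨⟨⟨ha1, haA⟩, hn1, hnM⟩, ⟨ha1', haA'⟩, hn1', hnM'⟩, heq⟩ := hz
    obtain ⟨g, α, α', hg, hco, rfl, rfl⟩ := Nat.exists_coprime' (m := a) (n := a')
      (Nat.gcd_pos_of_pos_left _ ha1)
    have heq' : n * α' = n' * α := by
      apply Nat.eq_of_mul_eq_mul_right hg
      linarith
    obtain ⟨t, rfl⟩ : α ∣ n := hco.dvd_of_dvd_mul_right (Dvd.intro_left _ heq'.symm)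
    have hα : 0 < α := Nat.pos_of_mul_pos_right ha1
    have hα' : 0 < α' := Nat.pos_of_mul_pos_right ha1'
    obtain rfl : n' = t * α' := by
      apply Nat.eq_of_mul_eq_mul_right hα
      rw [← heq']
      ring
    have ht : 0 < t := Nat.pos_of_mul_pos_left hn1
    refine ⟨⟨(g, α), (α', t)⟩, ?_, ?_⟩
    · simp only [Finset.coe_sigma, Set.mem_sigma_iff, Finset.mem_coe, Finset.mem_product,
        Finset.mem_Icc]
      refine ⟨⟨⟨hg, ?_⟩, hα, ?_⟩, ⟨hα', ?_⟩, ht, ?_⟩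
      · exact (Nat.le_mul_of_pos_left _ hα).trans haA
      · exact (Nat.le_mul_of_pos_right _ hg).trans haA
      · rwa [Nat.le_div_iff_mul_le hg]
      · rwa [Nat.le_div_iff_mul_le hα, mul_comm]
    · simp only [Prod.mk.injEq]
      refine ⟨⟨mul_comm _ _, mul_comm _ _⟩, mul_comm _ _, trivial⟩
  have h2 : ∑ g ∈ Finset.Icc 1 A, ((g : ℝ))⁻¹ ≤ 1 + Real.log A := by
    have h3 := harmonic_le_one_add_log A
    rw [harmonic_eq_sum_Icc] at h3
    push_cast at h3
    exact h3
  have h0 : 0 ≤ ∑ g ∈ Finset.Icc 1 A, ((g : ℝ))⁻¹ := Finset.sum_nonneg fun _ _ => by positivity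
  calc _ ≤ (((Finset.Icc 1 A ×ˢ Finset.Icc 1 A).sigma
        fun w => Finset.Icc 1 (A / w.1) ×ˢ Finset.Icc 1 (M / w.2)).card : ℝ) := by exact_mod_cast h1
    _ = ∑ g ∈ Finset.Icc 1 A, ∑ α ∈ Finset.Icc 1 A, ((A / g : ℕ) : ℝ) * ((M / α : ℕ) : ℝ) := by
        rw [Finset.card_sigma, Finset.sum_product]
        simp
    _ ≤ ∑ g ∈ Finset.Icc 1 A, ∑ α ∈ Finset.Icc 1 A, ((A : ℝ) / g) * ((M : ℝ) / α) := by
        gcongr <;> exact Nat.cast_div_le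
    _ = A * M * (∑ g ∈ Finset.Icc 1 A, ((g : ℝ))⁻¹) ^ 2 := by
        rw [sq, Finset.sum_mul_sum, Finset.mul_sum]
        refine Finset.sum_congr rfl fun g _ => ?_
        rw [Finset.mul_sum]
        refine Finset.sum_congr rfl fun α _ => ?_
        ring
    _ ≤ _ := by gcongr

theorem norm_sum_mul_le_of_norm_sub_le (s w : ℕ → ℂ) {W D : ℝ} (hw : ∀ b, ‖w b‖ ≤ W)
    (hD : ∀ b, ‖w (b + 1) - w b‖ ≤ D) (B : ℕ) :
    ‖∑ b ∈ Finset.Icc 1 B, s b * w b‖ ≤ W * ‖∑ b ∈ Finset.Icc 1 B, s b‖ +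
      D * ∑ k ∈ Finset.range B, ‖∑ b ∈ Finset.Icc 1 k, s b‖ := by
  have h1 : ∀ B, ∑ b ∈ Finset.Icc 1 B, s b * w b = w B * ∑ b ∈ Finset.Icc 1 B, s b -
      ∑ k ∈ Finset.range B, (w (k + 1) - w k) * ∑ b ∈ Finset.Icc 1 k, s b := by
    intro B
    induction B with
    | zero => simp
    | succ B ih =>
      rw [Finset.sum_Icc_succ_top (by omega), Finset.sum_Icc_succ_top (by omega),
        Finset.sum_range_succ, ih]
      ring
  rw [h1, Finset.mul_sum (Finset.range B) (fun k => ‖∑ b ∈ Finset.Icc 1 k, s b‖)]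
  refine (norm_sub_le _ _).trans (add_le_add ?_ (norm_sum_le_of_le _ fun k _ => ?_))
  · rw [norm_mul]
    gcongr
    exact hw B
  · rw [norm_mul]
    gcongr
    exact hD k

/-- As h ≤ N, the support condition N < n + h < 2N forces 0 < n < 2N, a range independent of h. -/
theorem smoothCharSum_eq_sum_shift {q : ℕ} {V : ℝ → ℂ} (hV : tsupport V ⊆ Set.Ioo 1 2)
    (χ : DirichletCharacter ℂ q) {N : ℝ} (hN : 1 ≤ N) {h : ℕ} (hh : (h : ℝ) ≤ N) :
    smoothCharSum V χ N = ∑ n ∈ Finset.Icc 1 ⌊2 * N⌋₊,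
      χ ((n : ZMod q) + h) * V (((n : ℝ) + h) / N) := by
  have hN0 : 0 < N := by linarith
  rw [smoothCharSum, ← (Equiv.addRight (h : ℤ)).tsum_eq,
    tsum_eq_sum (s := (Finset.Icc 1 ⌊2 * N⌋₊).map Nat.castEmbedding), Finset.sum_map]
  · simp
  · intro n hn
    rw [Equiv.coe_addRight]
    have h1 : V (((n + h : ℤ) : ℝ) / N) = 0 := by
      by_contra hne
      have h2 := hV (subset_tsupport V hne)
      rw [Set.mem_Ioo, one_lt_div hN0, div_lt_iff₀ hN0] at h2
      push_cast at h2
      have h3 : 0 < n := by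
        have : (0 : ℝ) < n := by linarith
        exact_mod_cast this
      obtain ⟨k, rfl⟩ := Int.eq_ofNat_of_zero_le h3.le
      refine hn (Finset.mem_map.2 ⟨k, Finset.mem_Icc.2 ⟨by omega, Nat.le_floor ?_⟩, by simp⟩)
      have : (0 : ℝ) ≤ h := Nat.cast_nonneg h
      simp only [Int.cast_natCast] at h2
      linarith
    rw [h1, mul_zero]

theorem card_collisions_le {q A M : ℕ} [Fact q.Prime] (hAM : A * M < q) :
    ((((Finset.Icc 1 A ×ˢ Finset.Icc 1 M) ×ˢ (Finset.Icc 1 A ×ˢ Finset.Icc 1 M)).filter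
      fun z => (z.1.2 : ZMod q) / z.1.1 = z.2.2 / z.2.1).card : ℝ) ≤
      A * M * (1 + Real.log A) ^ 2 := by
  refine le_trans (Nat.cast_le.2 (Finset.card_le_card fun z hz => ?_)) (card_mul_eq_mul_le A M)
  rw [Finset.mem_filter] at hz ⊢
  refine ⟨hz.1, ?_⟩
  obtain ⟨hz, heq⟩ := hz
  simp only [Finset.mem_product, Finset.mem_Icc] at hz
  obtain ⟨⟨⟨ha1, haA⟩, hn1, hnM⟩, ⟨ha1', haA'⟩, hn1', hnM'⟩ := hz
  have hne : ∀ a : ℕ, 1 ≤ a → a ≤ A → (a : ZMod q) ≠ 0 := by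
    intro a h1 h2 h3
    rw [ZMod.natCast_eq_zero_iff] at h3
    have h4 := Nat.le_of_dvd h1 h3
    have : A * 1 ≤ A * M := Nat.mul_le_mul_left _ (hn1.trans hnM)
    omega
  rw [div_eq_div_iff (hne _ ha1 haA) (hne _ ha1' haA')] at heq
  have h1 : z.1.2 * z.2.1 ≤ M * A := Nat.mul_le_mul hnM haA'
  have h2 : z.2.2 * z.1.1 ≤ M * A := Nat.mul_le_mul hnM' haA
  rw [mul_comm] at hAM
  have h3 : ((z.1.2 * z.2.1 : ℕ) : ZMod q) = ((z.2.2 * z.1.1 : ℕ) : ZMod q) := by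
    exact_mod_cast heq
  rwa [ZMod.natCast_eq_natCast_iff', Nat.mod_eq_of_lt (by omega), Nat.mod_eq_of_lt (by omega)]
    at h3

/-- The condition k^(2l) ≤ q makes both terms of the moment bound O(q^(3/2)). -/
theorem sum_norm_sum_div_add_pow_le {q : ℕ} [Fact q.Prime] {χ : DirichletCharacter ℂ q}
    (hχ : χ ≠ 1) {l k A M : ℕ} (hl : 1 ≤ l) (hk : k ^ (2 * l) ≤ q) (hAM : A * M < q) :
    (∑ z ∈ Finset.Icc 1 A ×ˢ Finset.Icc 1 M,
      ‖∑ b ∈ Finset.Icc 1 k, χ ((z.2 : ZMod q) / z.1 + b)‖) ^ (2 * l) ≤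
      ((A : ℝ) * M) ^ (2 * l - 1) * (1 + Real.log A) ^ 2 * ((l ^ (2 * l) + 2 * l) * (q * √q)) := by
  have hq : q.Prime := Fact.out
  have hkq : k < q := by
    rcases Nat.eq_zero_or_pos k with rfl | h0
    · exact hq.pos
    · have h1 : k ^ 2 ≤ k ^ (2 * l) := Nat.pow_le_pow_right h0 (by omega)
      have := hq.two_le
      nlinarith
  have hkl : (k : ℝ) ^ l ≤ √q := by
    apply Real.le_sqrt_of_sq_le
    rw [← pow_mul, mul_comm]
    exact_mod_cast hk
  have hk2 : (k : ℝ) ^ (2 * l) ≤ q := by exact_mod_cast hk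
  have hmom : ∑ x : ZMod q, ‖∑ b ∈ Finset.Icc 1 k, χ (x + b)‖ ^ (2 * l) ≤
      (l ^ (2 * l) + 2 * l) * (q * √q) := by
    refine (sum_norm_pow_le hχ hl hkq).trans ?_
    calc (l : ℝ) ^ (2 * l) * k ^ l * q + 2 * l * k ^ (2 * l) * √q
        ≤ (l : ℝ) ^ (2 * l) * √q * q + 2 * l * q * √q := by gcongr
      _ = _ := by ring
  have h := sum_comp_pow_le (Finset.Icc 1 A ×ˢ Finset.Icc 1 M)
    (fun z : ℕ × ℕ => (z.2 : ZMod q) / z.1)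
    (fun x => ‖∑ b ∈ Finset.Icc 1 k, χ (x + b)‖) (fun _ => norm_nonneg _) hl
  refine h.trans ?_
  have hcard : ((Finset.Icc 1 A ×ˢ Finset.Icc 1 M).card : ℝ) = A * M := by
    simp [Finset.card_product]
  rw [hcard]
  calc _ ≤ ((A : ℝ) * M) ^ (2 * (l - 1)) * (A * M * (1 + Real.log A) ^ 2) *
        ((l ^ (2 * l) + 2 * l) * (q * √q)) := by
        gcongr
        exact card_collisions_le hAM
    _ = _ := by
        rw [show 2 * l - 1 = 2 * (l - 1) + 1 by omega, pow_succ]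
        ring

/-- Average over the shifts h = ab. A unit step in b changes the argument of V by at most A/N, so
Abel summation over B steps costs D · AB/N ≤ D. -/
theorem mul_norm_smoothCharSum_le {q : ℕ} [Fact q.Prime] {V : ℝ → ℂ}
    (hV : tsupport V ⊆ Set.Ioo 1 2) {W D : ℝ} (hD0 : 0 ≤ D) (hW : ∀ t, ‖V t‖ ≤ W)
    (hD : ∀ t u, ‖V t - V u‖ ≤ D * |t - u|) (χ : DirichletCharacter ℂ q) {N : ℝ} (hN : 1 ≤ N)
    {A B : ℕ} (hB : 1 ≤ B) (hAB : (A : ℝ) * B ≤ N) (hA : A < q) {K : ℝ}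
    (hK : ∀ k ≤ B, ∑ z ∈ Finset.Icc 1 A ×ˢ Finset.Icc 1 ⌊2 * N⌋₊,
      ‖∑ b ∈ Finset.Icc 1 k, χ ((z.2 : ZMod q) / z.1 + b)‖ ≤ K) :
    A * B * ‖smoothCharSum V χ N‖ ≤ (W + D) * K := by
  set P := Finset.Icc 1 A ×ˢ Finset.Icc 1 ⌊2 * N⌋₊ with hP
  have hN0 : 0 < N := by linarith
  have hB0 : (0 : ℝ) < B := by exact_mod_cast hB
  have hW0 : 0 ≤ W := (norm_nonneg _).trans (hW 0)
  have hsum : (A * B : ℂ) * smoothCharSum V χ N = ∑ z ∈ P, χ (z.1 : ZMod q) *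
      ∑ b ∈ Finset.Icc 1 B, χ ((z.2 : ZMod q) / z.1 + b) *
        V (((z.2 : ℝ) + (z.1 * b : ℕ)) / N) := by
    have h1 : (A * B : ℂ) * smoothCharSum V χ N =
        ∑ a ∈ Finset.Icc 1 A, ∑ b ∈ Finset.Icc 1 B, smoothCharSum V χ N := by
      simp [mul_assoc]
    rw [h1, hP, Finset.sum_product]
    refine Finset.sum_congr rfl fun a ha => ?_
    rw [Finset.mem_Icc] at ha
    have ha0 : (a : ZMod q) ≠ 0 := by
      intro h3
      rw [ZMod.natCast_eq_zero_iff] at h3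
      have h4 := Nat.le_of_dvd ha.1 h3
      omega
    simp only [Finset.mul_sum]
    rw [Finset.sum_comm]
    refine Finset.sum_congr rfl fun b hb => ?_
    rw [Finset.mem_Icc] at hb
    rw [smoothCharSum_eq_sum_shift hV χ hN (h := a * b)]
    · refine Finset.sum_congr rfl fun n _ => ?_
      rw [← mul_assoc, ← map_mul]
      congr 2
      push_cast
      field_simp
    · refine le_trans ?_ hAB
      exact_mod_cast Nat.mul_le_mul ha.2 hb.2
  have hz : ∀ z ∈ P, ‖χ (z.1 : ZMod q) * ∑ b ∈ Finset.Icc 1 B, χ ((z.2 : ZMod q) / z.1 + b) *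
      V (((z.2 : ℝ) + (z.1 * b : ℕ)) / N)‖ ≤
      W * ‖∑ b ∈ Finset.Icc 1 B, χ ((z.2 : ZMod q) / z.1 + b)‖ +
      D * (A / N) * ∑ k ∈ Finset.range B, ‖∑ b ∈ Finset.Icc 1 k, χ ((z.2 : ZMod q) / z.1 + b)‖ := by
    intro z hz
    rw [hP, Finset.mem_product, Finset.mem_Icc] at hz
    rw [norm_mul]
    refine (mul_le_of_le_one_left (norm_nonneg _) (DirichletCharacter.norm_le_one χ _)).trans ?_
    refine norm_sum_mul_le_of_norm_sub_le _ (fun b => V (((z.2 : ℝ) + (z.1 * b : ℕ)) / N))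
      (fun b => hW _) (fun b => (hD _ _).trans ?_) B
    gcongr
    have h1 : ((z.2 : ℝ) + (z.1 * (b + 1) : ℕ)) / N - ((z.2 : ℝ) + (z.1 * b : ℕ)) / N =
        z.1 / N := by
      push_cast
      ring
    rw [h1, abs_of_nonneg (by positivity)]
    gcongr
    exact hz.1.2
  have hnorm : A * B * ‖smoothCharSum V χ N‖ = ‖(A * B : ℂ) * smoothCharSum V χ N‖ := by
    simp
  rw [hnorm, hsum]
  have hK0 : 0 ≤ K := le_trans (Finset.sum_nonneg fun _ _ => norm_nonneg _) (hK 0 (Nat.zero_le _))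
  calc _ ≤ ∑ z ∈ P, (W * ‖∑ b ∈ Finset.Icc 1 B, χ ((z.2 : ZMod q) / z.1 + b)‖ +
      D * (A / N) * ∑ k ∈ Finset.range B,
        ‖∑ b ∈ Finset.Icc 1 k, χ ((z.2 : ZMod q) / z.1 + b)‖) := norm_sum_le_of_le _ hz
    _ = W * ∑ z ∈ P, ‖∑ b ∈ Finset.Icc 1 B, χ ((z.2 : ZMod q) / z.1 + b)‖ +
        D * (A / N) * ∑ k ∈ Finset.range B, ∑ z ∈ P,
          ‖∑ b ∈ Finset.Icc 1 k, χ ((z.2 : ZMod q) / z.1 + b)‖ := by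
        rw [Finset.sum_add_distrib, ← Finset.mul_sum, ← Finset.mul_sum,
          Finset.sum_comm (s := Finset.range B)]
    _ ≤ W * K + D * (A / N) * ∑ k ∈ Finset.range B, K := by
        gcongr with k hk
        · exact hK B le_rfl
        · exact hK k (Finset.mem_range.1 hk).le
    _ = W * K + D * ((A * B) / N) * K := by
        rw [Finset.sum_const, Finset.card_range, nsmul_eq_mul]
        ring
    _ ≤ W * K + D * 1 * K := by
        gcongr
        rwa [div_le_one hN0]
    _ = _ := by ring

theorem norm_smoothCharSum_pow_mul_le {q : ℕ} [Fact q.Prime] {V : ℝ → ℂ}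
    (hV : tsupport V ⊆ Set.Ioo 1 2) {W D : ℝ} (hD0 : 0 ≤ D) (hW : ∀ t, ‖V t‖ ≤ W)
    (hD : ∀ t u, ‖V t - V u‖ ≤ D * |t - u|) {χ : DirichletCharacter ℂ q} (hχ : χ ≠ 1) {N : ℝ}
    (hN : 1 ≤ N) {l A B : ℕ} (hl : 1 ≤ l) (hA1 : 1 ≤ A) (hB : 1 ≤ B) (hAB : (A : ℝ) * B ≤ N)
    (hAM : A * ⌊2 * N⌋₊ < q) (hBq : B ^ (2 * l) ≤ q) :
    ‖smoothCharSum V χ N‖ ^ (2 * l) * (A * B ^ (2 * l)) ≤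
      (W + D) ^ (2 * l) * (l ^ (2 * l) + 2 * l) * (2 * N) ^ (2 * l - 1) *
        (1 + Real.log q) ^ 2 * (q * √q) := by
  have hq : q.Prime := Fact.out
  have hM : 1 ≤ ⌊2 * N⌋₊ := Nat.le_floor (by push_cast; linarith)
  have hAq : A < q := lt_of_le_of_lt (Nat.le_mul_of_pos_right _ hM) hAM
  have hW0 : 0 ≤ W := (norm_nonneg _).trans (hW 0)
  have hA0 : (0 : ℝ) < A := by exact_mod_cast hA1
  have hlogA : 0 ≤ Real.log A := Real.log_natCast_nonneg A
  set M := ⌊2 * N⌋₊ with hMdef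
  have hMN : (M : ℝ) ≤ 2 * N := Nat.floor_le (by linarith)
  set Z : ℝ := ((A : ℝ) * M) ^ (2 * l - 1) * (1 + Real.log A) ^ 2 *
    ((l ^ (2 * l) + 2 * l) * (q * √q)) with hZ
  have hZ0 : 0 ≤ Z := by positivity
  have hK : ∀ k ≤ B, ∑ z ∈ Finset.Icc 1 A ×ˢ Finset.Icc 1 M,
      ‖∑ b ∈ Finset.Icc 1 k, χ ((z.2 : ZMod q) / z.1 + b)‖ ≤ Z ^ (((2 * l : ℕ) : ℝ)⁻¹) := by
    intro k hk
    rw [Real.le_rpow_inv_iff_of_pos (Finset.sum_nonneg fun _ _ => norm_nonneg _) hZ0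
      (by exact_mod_cast (by omega : 0 < 2 * l)), Real.rpow_natCast]
    exact sum_norm_sum_div_add_pow_le hχ hl ((Nat.pow_le_pow_left hk _).trans hBq) hAM
  have h1 := mul_norm_smoothCharSum_le hV hD0 hW hD χ hN hB hAB hAq hK
  have h2 := pow_le_pow_left₀ (by positivity) h1 (2 * l)
  rw [mul_pow (W + D), Real.rpow_inv_natCast_pow hZ0 (by omega)] at h2
  have hpow : (A : ℝ) ^ (2 * l) = A ^ (2 * l - 1) * A := by
    rw [← pow_succ]
    congr 1
    omega
  -- The left side carries A^(2l) but the right only A^(2l-1): this surviving A is the gain from the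
  -- shifts by a.
  have h3 : (A : ℝ) ^ (2 * l - 1) * (‖smoothCharSum V χ N‖ ^ (2 * l) * (A * B ^ (2 * l))) ≤
      (A : ℝ) ^ (2 * l - 1) * ((W + D) ^ (2 * l) * (l ^ (2 * l) + 2 * l) * M ^ (2 * l - 1) *
        (1 + Real.log A) ^ 2 * (q * √q)) := by
    calc _ = ((A : ℝ) * B * ‖smoothCharSum V χ N‖) ^ (2 * l) := by
          rw [mul_pow, mul_pow, hpow]
          ring
      _ ≤ _ := h2
      _ = _ := by
          rw [hZ, mul_pow]
          ring
  refine (le_of_mul_le_mul_left h3 (by positivity)).trans ?_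
  gcongr

/-- In the variable y = 1 + log q the quotient is log y / (y - 1). -/
theorem tendsto_log_one_add_log_div_log :
    Tendsto (fun q : ℕ => Real.log (1 + Real.log q) / Real.log q) atTop (𝓝 0) := by
  have h1 := (Real.tendsto_pow_log_div_mul_add_atTop 1 (-1) 1 one_ne_zero).comp
    ((tendsto_atTop_add_const_left atTop 1 Real.tendsto_log_atTop).comp
      tendsto_natCast_atTop_atTop)
  refine h1.congr fun q => ?_
  simp

end burgess

/-! ### Choice of parameters and conclusion -/

theorem mainTheorem2 :
    ∃ η : ℕ → ℝ, Tendsto η atTop (𝓝 0) ∧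
      ∀ (V : ℝ → ℂ) (_hV : IsSmoothBump V) (l : ℕ) (_hl : 1 ≤ l),
        ∃ C : ℝ, 0 < C ∧
          ∀ (q : ℕ) (_hq : q.Prime) (χ : DirichletCharacter ℂ q) (_hχ : χ ≠ 1) (N : ℝ)
            (_hN : 1 ≤ N)
            (_hN₁ : (q : ℝ) ^ (1 / (2 * (l : ℝ))) ≤ N)
            (_hN₂ : N < 1 / 2 * (q : ℝ) ^ (1 / 2 + 1 / (4 * (l : ℝ)))),
            ‖smoothCharSum V χ N‖ ≤
              C * (q : ℝ) ^ η q *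
                (N * (N / (q : ℝ) ^ (1 / 4 + 1 / (4 * (l : ℝ)))) ^ (-1 / (l : ℝ))) := by
  -- This η makes q^η(q) equal to 1 + log q, the only loss in the argument.
  refine ⟨_, tendsto_log_one_add_log_div_log, fun V hV l hl => ?_⟩
  obtain ⟨hVs, hVc, hVt⟩ := hV
  obtain ⟨W, hW⟩ := hVs.continuous.bounded_above_of_compact_support hVc
  obtain ⟨D, hD⟩ := hVs.lipschitzWith_of_hasCompactSupport hVc (by simp)
  have hD' : ∀ t u, ‖V t - V u‖ ≤ D * |t - u| := fun t u => by
    simpa [dist_eq_norm] using hD.dist_le_mul t u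
  set K : ℝ := (W + D) ^ (2 * l) * (l ^ (2 * l) + 2 * l) * 2 ^ (4 * l) with hK
  refine ⟨max 1 K, by positivity, fun q hq χ hχ N hN hN₁ hN₂ => ?_⟩
  have : Fact q.Prime := ⟨hq⟩
  have hW0 : 0 ≤ W := (norm_nonneg _).trans (hW 0)
  have hl0 : (l : ℝ) ≠ 0 := by exact_mod_cast (by omega : l ≠ 0)
  have hq0 : (0 : ℝ) < q := by exact_mod_cast hq.pos
  have hq1 : (1 : ℝ) < q := by exact_mod_cast hq.one_lt
  have hN0 : 0 < N := by linarith
  have hlog : 0 < Real.log q := Real.log_pos hq1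
  have hη : (q : ℝ) ^ (Real.log (1 + Real.log q) / Real.log q) = 1 + Real.log q := by
    rw [Real.rpow_def_of_pos hq0, mul_div_cancel₀ _ hlog.ne', Real.exp_log (by positivity)]
  rw [hη]
  set Y : ℝ := (q : ℝ) ^ (1 / (2 * (l : ℝ))) with hY
  have hYpow : Y ^ (2 * l) = q := by
    rw [hY, ← Real.rpow_natCast, ← Real.rpow_mul hq0.le]
    push_cast
    rw [one_div_mul_cancel (by positivity), Real.rpow_one]
  have hY1 : 1 ≤ Y := Real.one_le_rpow hq1.le (by positivity)
  set Z : ℝ := (q : ℝ) ^ (1 / 4 + 1 / (4 * (l : ℝ))) with hZ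
  have hZ0 : 0 < Z := by positivity
  have hZ2 : Z ^ 2 = √q * Y := by
    rw [hZ, hY, Real.sqrt_eq_rpow, ← Real.rpow_add hq0, ← Real.rpow_natCast, ← Real.rpow_mul hq0.le]
    congr 1
    push_cast
    field_simp
    ring
  have hN2 : 4 * N ^ 2 < q * Y := by
    have h1 : ((q : ℝ) ^ (1 / 2 + 1 / (4 * (l : ℝ)))) ^ 2 = q * Y := by
      rw [hY, ← Real.rpow_natCast, ← Real.rpow_mul hq0.le]
      nth_rewrite 2 [← Real.rpow_one (q : ℝ)]
      rw [← Real.rpow_add hq0]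
      congr 1
      push_cast
      field_simp
      ring
    have h2 : (2 * N) ^ 2 < ((q : ℝ) ^ (1 / 2 + 1 / (4 * (l : ℝ)))) ^ 2 :=
      pow_lt_pow_left₀ (by linarith) (by positivity) two_ne_zero
    rw [h1] at h2
    linarith
  have hY0 : 0 < Y := by linarith
  have half : ∀ x : ℝ, 1 ≤ x → x / 2 ≤ (⌊x⌋₊ : ℝ) := by
    intro x hx
    have h1 := Nat.lt_floor_add_one x
    have h2 : (1 : ℝ) ≤ ⌊x⌋₊ := by exact_mod_cast Nat.le_floor (by simpa using hx)
    linarith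
  have hNY : 1 ≤ N / Y := (one_le_div hY0).2 hN₁
  set A := ⌊N / Y⌋₊ with hA
  set B := ⌊Y⌋₊ with hB
  have hAle : (A : ℝ) ≤ N / Y := Nat.floor_le (by positivity)
  have hBle : (B : ℝ) ≤ Y := Nat.floor_le (by positivity)
  have hA1 : 1 ≤ A := Nat.le_floor (by simpa using hNY)
  have hB1 : 1 ≤ B := Nat.le_floor (by simpa using hY1)
  have hAB : (A : ℝ) * B ≤ N := by
    calc (A : ℝ) * B ≤ N / Y * Y := by gcongr
      _ = N := div_mul_cancel₀ _ hY0.ne'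
  -- This is where the upper bound on N enters: A · 2N ≤ 2N²/Y < q. The lower bound N ≥ Y gave A ≥
  -- 1.
  have hAM : A * ⌊2 * N⌋₊ < q := by
    have h1 : ((⌊2 * N⌋₊ : ℕ) : ℝ) ≤ 2 * N := Nat.floor_le (by linarith)
    have h2 : (A : ℝ) * (⌊2 * N⌋₊ : ℕ) < q := by
      calc (A : ℝ) * (⌊2 * N⌋₊ : ℕ) ≤ N / Y * (2 * N) := by gcongr
        _ = 2 * N ^ 2 / Y := by ring
        _ < q := by
          rw [div_lt_iff₀ hY0]
          nlinarith
    exact_mod_cast h2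
  have hBq : B ^ (2 * l) ≤ q := by
    have h1 : (B : ℝ) ^ (2 * l) ≤ q := by
      rw [← hYpow]
      gcongr
    exact_mod_cast h1
  have hmain := norm_smoothCharSum_pow_mul_le hVt D.coe_nonneg hW hD' hχ hN hl hA1 hB1 hAB hAM hBq
  set S := ‖smoothCharSum V χ N‖ with hS
  set ℒ := 1 + Real.log q with hℒ
  have hℒ1 : 1 ≤ ℒ := by linarith
  set T := N * (N / Z) ^ (-1 / (l : ℝ)) with hT
  have hT0 : 0 ≤ T := by positivity
  have hTpow : T ^ (2 * l) * N ^ 2 = N ^ (2 * l) * (√q * Y) := by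
    have h1 : ((N / Z) ^ (-1 / (l : ℝ))) ^ (2 * l) = (Z / N) ^ 2 := by
      rw [← Real.rpow_natCast, ← Real.rpow_mul (by positivity)]
      have h2 : -1 / (l : ℝ) * ((2 * l : ℕ) : ℝ) = -((2 : ℕ) : ℝ) := by
        push_cast
        field_simp
      rw [h2, Real.rpow_neg (by positivity), Real.rpow_natCast, ← inv_pow, inv_div]
    rw [hT, mul_pow, h1, ← hZ2]
    field_simp
  have hAlow : N / Y / 2 ≤ A := half _ hNY
  have hBlow : (q : ℝ) / 2 ^ (2 * l) ≤ B ^ (2 * l) := by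
    rw [← hYpow, ← div_pow]
    exact pow_le_pow_left₀ (by positivity) (half _ hY1) _
  -- The constant 2^(4l) collects 2^(2l-1) from 2N, a factor 2 from rounding A, and 2^(2l) from
  -- rounding B.
  have hkey : S ^ (2 * l) ≤ K * ℒ ^ 2 * T ^ (2 * l) := by
    have h1 : S ^ (2 * l) * (N / Y / 2 * (q / 2 ^ (2 * l))) ≤
        (W + D) ^ (2 * l) * (l ^ (2 * l) + 2 * l) * (2 * N) ^ (2 * l - 1) * ℒ ^ 2 * (q * √q) :=
      le_trans (by gcongr) hmain
    have hpow2 : ∀ x : ℝ, x ^ (2 * l) = x ^ (2 * l - 1) * x := by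
      intro x
      rw [← pow_succ]
      congr 1
      omega
    have h3 : 0 < N / Y / 2 * ((q : ℝ) / 2 ^ (2 * l)) := by positivity
    refine le_of_mul_le_mul_right (h1.trans (le_of_eq ?_)) h3
    have h4 : T ^ (2 * l) = N ^ (2 * l) * (√q * Y) / N ^ 2 := by
      rw [← hTpow]
      field_simp
    rw [h4, hK, mul_pow 2 N, hpow2 N, show 4 * l = 2 * l + 2 * l by ring, pow_add, hpow2 2]
    field_simp
  refine le_of_pow_le_pow_left₀ (n := 2 * l) (by omega) (by positivity) (hkey.trans ?_)
  have hK1 : K ≤ max 1 K ^ (2 * l) :=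
    (le_max_right 1 K).trans (le_self_pow₀ (le_max_left 1 K) (by omega))
  have hℒ2 : ℒ ^ 2 ≤ ℒ ^ (2 * l) := pow_le_pow_right₀ hℒ1 (by omega)
  rw [mul_pow (max 1 K * ℒ) T, mul_pow (max 1 K) ℒ]
  exact mul_le_mul_of_nonneg_right
    (mul_le_mul hK1 hℒ2 (by positivity) (pow_nonneg (le_max_of_le_left zero_le_one) _))
    (pow_nonneg hT0 _)
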